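/- **Setting.** Let $\mathbb T\subset\mathbb R$ be a time scale, i.e. a closed set, with $0\in\mathbb T$ and $\sup\mathbb T=+\infty$; write $\mathbb T_a^+=\mathbb T\cap[a,\infty)$, $\sigma(t)=\inf\{s\in\mathbb T: s>t\}$, $\mu(t)=\sigma(t)-t$. A function on $\mathbb T_0^+$ is *rd-continuous* if it is continuous at right-dense points ($\sigma(t)=t$) and has finite left limits at left-dense points. The $\Delta$-derivative $f^\Delta(t)$ is the $\gamma$ such that for every $\eta>0$ one has $|f(\sigma(t))-f(s)-(\sigma(t)-s)\gamma|\le\eta|\sigma(t)-s|$ for all $s$ of the time scale near $t$; the $\Delta$-integral is $\int_\tau^s f\,\Delta t=F(s)-F(\tau)$ with $F^\Delta=f$. For rd-continuous $p$ with $1+\mu p>0$ put $e_p(t,s)=\exp\int_s^t\xi_{\mu(\tau)}(p(\tau))\,\Delta\tau$, where $\xi_h(z)=\log(1+zh)/h$ for $h\ne0$ and $\xi_0(z)=z$. Let $E$ be a finite-dimensional real normed space (for instance $\mathbb R^n$ with any norm $|\cdot|$), let $B_r=\{x\in E:|x|<r\}$, and let $\mathcal A$ be a bounded rd-continuous function on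 $\mathbb T_0^+$ whose values are linear operators on $E$ (matrices, with the operator norm), regressive in the sense that $I+\mu(t)\mathcal A(t)$ is invertible for all $t\in\mathbb T_0^+$. Let $\Phi_{\mathcal A}(t,s)$, $t\ge s$, be the fundamental matrix: $\Phi_{\mathcal A}^\Delta=\mathcal A(t)\Phi_{\mathcal A}$, $\Phi_{\mathcal A}(s,s)=I$. An *upper function* is an rd-continuous $u:\mathbb T_0^+\to\mathbb R$ with $1+\mu u>0$ for which there is $C>0$ with $|\Phi_{\mathcal A}(t,s)|\le C e_u(t,s)$ for all $t\ge s$ in $\mathbb T_0^+$. The *central upper exponent* is $$\chi(\mathcal A)=\inf_{u}\ \limsup_{\mathbb T\ni t\to\infty}\frac1t\int_0^t u(\tau)\,\Delta\tau,$$ the infimum being over all upper functions $u$. **Theorem.** If $\chi(\mathcal A)<0$, there are $\varepsilon>0$ and $\kappa>0$ such that for every $r>0$ and every $f:\mathbb T_0^+\times E\to E$ with $$|f(t,x)|\le\varepsilon|x|\qquad\text{for all }t\in\mathbb T_0^+,\ x\in B_r,$$ the zero solution of $x^\Delta=\mathcal A(t)x+f(t,x)$ has the following properties. 1. It is asymptotically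 stable: for every $t_0\in\mathbb T_0^+$ and $\eta>0$ there is $\delta>0$ such that every solution $x$, on any piece $\mathbb T\cap[t_0,b]$ with $b\in\mathbb T$, $b\ge t_0$, with $|x(t_0)|<\delta$ satisfies $|x(t)|<\eta$ on that piece; and for every $t_0\in\mathbb T_0^+$ there is $c>0$ such that every solution on $\mathbb T_{t_0}^+$ with $|x(t_0)|<c$ tends to $0$ as $t\to\infty$. 2. It is exponentially stable: for every $t_0\in\mathbb T_0^+$ there are $c,K>0$ such that every solution on any piece $\mathbb T\cap[t_0,b]$ with $|x(t_0)|<c$ satisfies $|x(t)|\le K|x(t_0)|e^{-\kappa(t-t_0)}$ on that piece. 3. If moreover, on $\mathbb T_0^+\times B_r$, $f$ is rd-continuous in $t$ for each fixed $x$, and for all $b$ and all $\rho<r$ the functions $f(t,\cdot)$, $t\in\mathbb T\cap[0,b]$, are Lipschitz on $\{|x|\le\rho\}$ with a common constant, then for every $t_0\in\mathbb T_0^+$ there is $c>0$ such that for every $|x_0|<c$ there is a solution on all of $\mathbb T_{t_0}^+$ with $x(t_0)=x_0$; it stays in $B_r$, and every solution on a piece $\mathbb T\cap[t_0,b]$ with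 the same initial value is its restriction. -/

import Mathlib

open Set Filter Topology

noncomputable section

namespace TimeScale

/-! A time scale is a closed set `S` of real numbers. Functions on `S` are represented by functions
on `ℝ` of which only the values on `S` matter. -/

/-- The part `[a, ∞) ∩ T` of the time scale `T`. -/
def plus (T : Set ℝ) (a : ℝ) : Set ℝ := T ∩ Ici a

/-- The part `[a, b] ∩ T` of the time scale `T`. -/
def segment (T : Set ℝ) (a b : ℝ) : Set ℝ := T ∩ Icc a b

/-- Forward jump operator. It is only used at points `t ∈ S` that are not the maximum of `S`. -/
def sigma (S : Set ℝ) (t : ℝ) : ℝ := sInf {s | s ∈ S ∧ t < s}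

/-- Graininess. -/
def mu (S : Set ℝ) (t : ℝ) : ℝ := sigma S t - t

/-- `f` is rd-continuous on `S`: it is continuous at right-dense points and has (finite) left-sided
limits at left-dense points. -/
def RdContinuous {X : Type*} [TopologicalSpace X] (S : Set ℝ) (f : ℝ → X) : Prop :=
  (∀ t ∈ S, sigma S t = t → ContinuousWithinAt f S t) ∧
  (∀ t ∈ S, t ∈ closure (S ∩ Iio t) → ∃ l : X, Tendsto f (𝓝[S ∩ Iio t] t) (𝓝 l))

/-- `f` is `Δ`-differentiable at `t` on the time scale `S`, with `Δ`-derivative `γ`. -/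
def HasDeltaDerivAt {X : Type*} [NormedAddCommGroup X] [NormedSpace ℝ X]
    (S : Set ℝ) (f : ℝ → X) (γ : X) (t : ℝ) : Prop :=
  ∀ ε > 0, ∃ W ∈ 𝓝 t, ∀ s ∈ W ∩ S,
    ‖(f (sigma S t) - f s) - (sigma S t - s) • γ‖ ≤ ε * |sigma S t - s|

/-- `F` is a `Δ`-antiderivative of `f` on `S`. -/
def IsDeltaAntideriv (S : Set ℝ) (f F : ℝ → ℝ) : Prop :=
  ∀ t ∈ S, HasDeltaDerivAt S F (f t) t

open Classical in
/-- The Cauchy `Δ`-integral `∫_τ^s f(t) Δt = F(s) - F(τ)`, `F` a `Δ`-antiderivative of `f` on `S`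
(and `0` if there is none, which does not happen for rd-continuous `f`). -/
def deltaIntegral (S : Set ℝ) (f : ℝ → ℝ) (τ s : ℝ) : ℝ :=
  if h : ∃ F, IsDeltaAntideriv S f F then h.choose s - h.choose τ else 0

/-- The cylinder transformation `ξ_h`, for `1 + z h > 0`. -/
def xi (h z : ℝ) : ℝ := if h = 0 then z else Real.log (1 + z * h) / h

/-- `p` is positively regressive on `S`. -/
def PositivelyRegressive (S : Set ℝ) (p : ℝ → ℝ) : Prop :=
  ∀ t ∈ S, 0 < 1 + mu S t * p t

/-- The generalized exponential function `e_p(t, s)` of a positively regressive function `p`. -/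
def expFun (S : Set ℝ) (p : ℝ → ℝ) (t s : ℝ) : ℝ :=
  Real.exp (deltaIntegral S (fun τ => xi (mu S τ) (p τ)) s t)

/-- `x` is a solution of `x^Δ = F(t, x)` on `J`: it is continuous on `J` and satisfies the equation
at every point of `J`, except for the maximum of `J` if there is one. -/
def IsSolutionOn {X : Type*} [NormedAddCommGroup X] [NormedSpace ℝ X]
    (J : Set ℝ) (F : ℝ → X → X) (x : ℝ → X) : Prop :=
  ContinuousOn x J ∧
  ∀ t ∈ J, (∃ s ∈ J, t < s) → HasDeltaDerivAt J x (F t (x t)) t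

section Linear

variable {E : Type*} [NormedAddCommGroup E] [NormedSpace ℝ E]

/-- The matrix function `A` is regressive on `S`. -/
def Regressive (S : Set ℝ) (A : ℝ → E →L[ℝ] E) : Prop :=
  ∀ t ∈ S, IsUnit (1 + mu S t • A t)

open Classical in
/-- The fundamental matrix `Φ_A(t, t₀)`, `t ≥ t₀`: the solution on `[t₀, ∞) ∩ T` of
`Φ^Δ = A(t) Φ` with `Φ(t₀, t₀) = 1` (and `0` if there is none, which does not happen for
rd-continuous `A`). -/
def fundamentalMatrix (T : Set ℝ) (A : ℝ → E →L[ℝ] E) (t t₀ : ℝ) : E →L[ℝ] E :=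
  if h : ∃ X : ℝ → E →L[ℝ] E, IsSolutionOn (plus T t₀) (fun τ Y => A τ * Y) X ∧ X t₀ = 1
  then h.choose t else 0

/-- `u` is an upper function for `x^Δ = A(t) x` on `[0, ∞) ∩ T`. A real function `u` whose
generalized exponential bounds an invertible matrix from above is necessarily positively
regressive, since `e_u(σ(t), t) = 1 + μ(t) u(t)`. -/
def IsUpperFunction (T : Set ℝ) (A : ℝ → E →L[ℝ] E) (u : ℝ → ℝ) : Prop :=
  RdContinuous (plus T 0) u ∧ PositivelyRegressive (plus T 0) u ∧
  ∃ C > 0, ∀ s ∈ plus T 0, ∀ t ∈ plus T 0, s ≤ t →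
    ‖fundamentalMatrix T A t s‖ ≤ C * expFun (plus T 0) u t s

/-- `χ_u`, the upper limit of `(1/t) ∫_0^t u(τ) Δτ` as `t → ∞` in `T`. -/
def upperMean (T : Set ℝ) (u : ℝ → ℝ) : EReal :=
  limsup (fun t : ℝ => ((1 / t * deltaIntegral (plus T 0) u 0 t : ℝ) : EReal))
    (atTop ⊓ 𝓟 (plus T 0))

/-- The central upper exponent of `x^Δ = A(t) x`. -/
def centralUpperExponent (T : Set ℝ) (A : ℝ → E →L[ℝ] E) : EReal :=
  ⨅ u ∈ {u : ℝ → ℝ | IsUpperFunction T A u}, upperMean T u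

end Linear

section Stability

variable {E : Type*} [NormedAddCommGroup E] [NormedSpace ℝ E]

/-- The zero solution of `x^Δ = F(t, x)` is stable. All solutions are considered, also those that
are only given on a bounded piece of the time scale. -/
def ZeroStable (T : Set ℝ) (F : ℝ → E → E) : Prop :=
  ∀ t₀ ∈ plus T 0, ∀ ε > 0, ∃ δ > 0, ∀ b ∈ plus T t₀, ∀ x : ℝ → E,
    IsSolutionOn (segment T t₀ b) F x → ‖x t₀‖ < δ → ∀ t ∈ segment T t₀ b, ‖x t‖ < ε

/-- The zero solution of `x^Δ = F(t, x)` is asymptotically stable. -/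
def ZeroAsymptoticallyStable (T : Set ℝ) (F : ℝ → E → E) : Prop :=
  ZeroStable T F ∧
  ∀ t₀ ∈ plus T 0, ∃ c > 0, ∀ x : ℝ → E,
    IsSolutionOn (plus T t₀) F x → ‖x t₀‖ < c → Tendsto x (atTop ⊓ 𝓟 (plus T t₀)) (𝓝 0)

/-- The zero solution of `x^Δ = F(t, x)` is exponentially stable with rate `κ`
(not necessarily uniformly in the initial time). -/
def ZeroExponentiallyStable (T : Set ℝ) (F : ℝ → E → E) (κ : ℝ) : Prop :=
  ∀ t₀ ∈ plus T 0, ∃ c > 0, ∃ K > 0, ∀ b ∈ plus T t₀, ∀ x : ℝ → E,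
    IsSolutionOn (segment T t₀ b) F x → ‖x t₀‖ < c →
      ∀ t ∈ segment T t₀ b, ‖x t‖ ≤ K * ‖x t₀‖ * Real.exp (-κ * (t - t₀))

/-- `f` is rd-continuous in `t` and locally Lipschitz in `x` on `([0, ∞) ∩ T) × B_r`. -/
def RegularOn (T : Set ℝ) (r : ℝ) (f : ℝ → E → E) : Prop :=
  (∀ x ∈ Metric.ball (0 : E) r, RdContinuous (plus T 0) (fun t => f t x)) ∧
  (∀ b : ℝ, ∀ ρ < r, ∃ L : NNReal, ∀ t ∈ segment T 0 b,
    LipschitzOnWith L (f t) (Metric.closedBall (0 : E) ρ))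

/-- For small initial values the solution `x(t, t₀, x₀)` of `x^Δ = F(t, x)` exists on the whole of
`[t₀, ∞) ∩ T`, stays in `B_r`, and every solution with the same initial value on a bounded piece
of the time scale is a restriction of it. -/
def SmallSolutionsGlobal (T : Set ℝ) (r : ℝ) (F : ℝ → E → E) : Prop :=
  ∀ t₀ ∈ plus T 0, ∃ c > 0, ∀ x₀ : E, ‖x₀‖ < c →
    ∃ x : ℝ → E, IsSolutionOn (plus T t₀) F x ∧ x t₀ = x₀ ∧
      (∀ t ∈ plus T t₀, x t ∈ Metric.ball (0 : E) r) ∧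
      ∀ b ∈ plus T t₀, ∀ y : ℝ → E, IsSolutionOn (segment T t₀ b) F y → y t₀ = x₀ →
        EqOn y x (segment T t₀ b)

end Stability

end TimeScale

end

noncomputable section

namespace TimeScale

section

variable {X : Type*} [NormedAddCommGroup X] [NormedSpace ℝ X]

/-! ### The forward jump operator -/

section Sigma

variable {T : Set ℝ} {a b s t : ℝ}

lemma bddBelow_later (T : Set ℝ) (t : ℝ) : BddBelow {s | s ∈ T ∧ t < s} :=
  ⟨t, fun _ hs => hs.2.le⟩

lemma sigma_le (hs : s ∈ T) (hts : t < s) : sigma T t ≤ s :=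
  csInf_le (bddBelow_later T t) ⟨hs, hts⟩

lemma le_sigma (hs : s ∈ T) (hts : t < s) : t ≤ sigma T t :=
  le_csInf ⟨s, hs, hts⟩ fun _ h => h.2.le

lemma sigma_mem (hT : IsClosed T) (hs : s ∈ T) (hts : t < s) : sigma T t ∈ T :=
  closure_minimal (fun _ h => h.1) hT
    (csInf_mem_closure (s := {s | s ∈ T ∧ t < s}) ⟨s, hs, hts⟩ (bddBelow_later T t))

lemma exists_mem_Ioo_of_sigma_lt (hs : s ∈ T) (hts : t < s) {c : ℝ} (h : sigma T t < c) :
    ∃ z ∈ T, t < z ∧ z < c := by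
  obtain ⟨z, hz, hzc⟩ := exists_lt_of_csInf_lt (s := {s | s ∈ T ∧ t < s}) ⟨s, hs, hts⟩ h
  exact ⟨z, hz.1, hz.2, hzc⟩

lemma sigma_plus (hat : a ≤ t) : sigma (plus T a) t = sigma T t := by
  unfold sigma plus
  congr 1
  ext s
  exact ⟨fun h => ⟨h.1.1, h.2⟩, fun h => ⟨⟨h.1, hat.trans h.2.le⟩, h.2⟩⟩

lemma sigma_segment (hat : a ≤ t) (hb : b ∈ T) (htb : t < b) :
    sigma (segment T a b) t = sigma T t := by
  apply le_antisymm
  · refine le_csInf ⟨b, hb, htb⟩ fun s hs => ?_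
    rcases le_total s b with h | h
    · exact sigma_le (T := segment T a b) ⟨hs.1, hat.trans hs.2.le, h⟩ hs.2
    · exact (sigma_le (T := segment T a b) ⟨hb, hat.trans htb.le, le_rfl⟩ htb).trans h
  · have hne : {s | s ∈ segment T a b ∧ t < s}.Nonempty :=
      ⟨b, ⟨hb, hat.trans htb.le, le_rfl⟩, htb⟩
    exact le_csInf hne fun s hs => sigma_le hs.1.1 hs.2

lemma isCompact_segment (hT : IsClosed T) (a b : ℝ) : IsCompact (segment T a b) :=
  isCompact_Icc.inter_left hT

lemma segment_subset_plus (T : Set ℝ) (a b : ℝ) : segment T a b ⊆ plus T a :=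
  fun _ h => ⟨h.1, h.2.1⟩

lemma plus_subset_plus (T : Set ℝ) (h : a ≤ b) : plus T b ⊆ plus T a :=
  fun _ ht => ⟨ht.1, h.trans ht.2⟩

end Sigma

/-- Induction along a time scale. -/
theorem segment_induction {T : Set ℝ} (hT : IsClosed T) {a b : ℝ} (haT : a ∈ T) {Q : ℝ → Prop}
    (ha : Q a)
    (jump : ∀ t ∈ segment T a b, t < b → t < sigma T t → Q t → Q (sigma T t))
    (dense : ∀ t ∈ segment T a b, t < b → sigma T t = t → Q t → ∀ᶠ s in 𝓝[T ∩ Ioi t] t, Q s)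
    (left : ∀ t ∈ segment T a b, t ∈ closure (segment T a b ∩ Iio t) →
      (∀ s ∈ segment T a b, s < t → Q s) → Q t) :
    ∀ t ∈ segment T a b, Q t := by
  by_contra! hcon
  obtain ⟨z, hz, hzQ⟩ := hcon
  have hJ : IsClosed (segment T a b) := (isCompact_segment hT a b).isClosed
  set Z : Set ℝ := {s | s ∈ segment T a b ∧ ¬ Q s} with hZdef
  have hZne : Z.Nonempty := ⟨z, hz, hzQ⟩
  have hZbdd : BddBelow Z := ⟨a, fun s hs => hs.1.2.1⟩
  set m := sInf Z with hm
  have hmcl : m ∈ closure Z := csInf_mem_closure hZne hZbdd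
  have hmJ : m ∈ segment T a b := closure_minimal (fun _ h => h.1) hJ hmcl
  have below : ∀ s ∈ segment T a b, s < m → Q s := by
    intro s hs hsm
    by_contra hsQ
    exact absurd (csInf_le hZbdd (show s ∈ Z from ⟨hs, hsQ⟩)) (not_le.2 hsm)
  have hQm : Q m := by
    by_cases hcl : m ∈ closure (segment T a b ∩ Iio m)
    · exact left m hmJ hcl below
    rcases hmJ.2.1.eq_or_lt with h | ham
    · rwa [← h]
    have hne : (segment T a b ∩ Iio m).Nonempty :=
      ⟨a, ⟨haT, le_rfl, ham.le.trans hmJ.2.2⟩, ham⟩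
    have hbd : BddAbove (segment T a b ∩ Iio m) := ⟨m, fun _ h => h.2.le⟩
    set q := sSup (segment T a b ∩ Iio m) with hq
    have hqcl : q ∈ closure (segment T a b ∩ Iio m) := csSup_mem_closure hne hbd
    have hqJ : q ∈ segment T a b := closure_minimal (fun _ h => h.1) hJ hqcl
    have hqm : q < m :=
      lt_of_le_of_ne (csSup_le hne fun _ h => h.2.le) fun h => hcl (h ▸ hqcl)
    have hσ : sigma T q = m := by
      refine le_antisymm (sigma_le hmJ.1 hqm) (le_csInf ⟨m, hmJ.1, hqm⟩ fun s hs => ?_)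
      by_contra! hsm
      exact absurd (le_csSup hbd
        ⟨⟨hs.1, hqJ.2.1.trans hs.2.le, hsm.le.trans hmJ.2.2⟩, hsm⟩) (not_le.2 hs.2)
    have := jump q hqJ (hqm.trans_le hmJ.2.2) (hσ ▸ hqm) (below q hqJ hqm)
    rwa [hσ] at this
  have hZm : ∀ s ∈ Z, m < s := fun s hs =>
    lt_of_le_of_ne (csInf_le hZbdd hs) fun h => hs.2 (h ▸ hQm)
  have hmb : m < b := (hZm z ⟨hz, hzQ⟩).trans_le hz.2.2
  have hσm : sigma T m = m := by
    refine le_antisymm (le_of_forall_gt fun c hc => ?_) (le_sigma hz.1 (hZm z ⟨hz, hzQ⟩))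
    obtain ⟨y, hy, hyc⟩ := exists_lt_of_csInf_lt hZne hc
    exact (sigma_le hy.1.1 (hZm y hy)).trans_lt hyc
  have hev := dense m hmJ hmb hσm hQm
  rw [eventually_nhdsWithin_iff] at hev
  obtain ⟨y, hyZ, hy⟩ := ((mem_closure_iff_frequently.1 hmcl).and_eventually hev).exists
  exact hyZ.2 (hy ⟨hyZ.1.1, hZm y hyZ⟩)

/-! ### Right-sided delta derivatives -/

/-- The consequences of `Δ`-differentiability at `t` for the values to the right of `t`. -/
structure HasRightDeltaDerivAt (T : Set ℝ) (x : ℝ → X) (γ : X) (t : ℝ) : Prop where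
  jump : t < sigma T t → x (sigma T t) = x t + (sigma T t - t) • γ
  dense : sigma T t = t → ∀ η > 0, ∀ᶠ s in 𝓝[T ∩ Ioi t] t,
    ‖x s - x t - (s - t) • γ‖ ≤ η * (s - t)

lemma HasDeltaDerivAt.apply_sigma {J : Set ℝ} {x : ℝ → X} {γ : X} {t : ℝ}
    (h : HasDeltaDerivAt J x γ t) (ht : t ∈ J) :
    x (sigma J t) = x t + (sigma J t - t) • γ := by
  have key : ‖(x (sigma J t) - x t) - (sigma J t - t) • γ‖ ≤ 0 := by
    refine le_of_forall_pos_le_add fun η hη => ?_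
    have hpos : (0 : ℝ) < |sigma J t - t| + 1 := by positivity
    obtain ⟨W, hW, hWs⟩ := h (η / (|sigma J t - t| + 1)) (by positivity)
    refine (hWs t ⟨mem_of_mem_nhds hW, ht⟩).trans ?_
    rw [zero_add, div_mul_eq_mul_div, div_le_iff₀ hpos]
    nlinarith
  have := sub_eq_zero.1 (norm_le_zero_iff.1 key)
  rw [← this]; abel

lemma HasDeltaDerivAt.right_of_sigma_eq {T J : Set ℝ} {x : ℝ → X} {γ : X} {t : ℝ}
    (h : HasDeltaDerivAt J x γ t) (ht : t ∈ J) (hσ : sigma J t = sigma T t)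
    (hJ : ∀ᶠ s in 𝓝[T ∩ Ioi t] t, s ∈ J) : HasRightDeltaDerivAt T x γ t := by
  refine ⟨fun _ => ?_, fun hd η hη => ?_⟩
  · rw [← hσ]; exact h.apply_sigma ht
  · obtain ⟨W, hW, hWs⟩ := h η hη
    filter_upwards [hJ, mem_nhdsWithin_of_mem_nhds hW, self_mem_nhdsWithin] with s hsJ hsW hs
    have h1 := hWs s ⟨hsW, hsJ⟩
    rw [hσ, hd, abs_sub_comm, abs_of_pos (sub_pos.2 hs.2), ← norm_neg] at h1
    have e : x s - x t - (s - t) • γ = -(x t - x s - (t - s) • γ) := by module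
    rwa [e]

lemma HasDeltaDerivAt.right_of_plus {T : Set ℝ} {x : ℝ → X} {γ : X} {a t : ℝ}
    (h : HasDeltaDerivAt (plus T a) x γ t) (ht : t ∈ plus T a) :
    HasRightDeltaDerivAt T x γ t := by
  refine h.right_of_sigma_eq ht (sigma_plus ht.2) ?_
  filter_upwards [self_mem_nhdsWithin] with s hs using ⟨hs.1, le_trans (mem_Ici.1 ht.2) (mem_Ioi.1 hs.2).le⟩

lemma HasDeltaDerivAt.right_of_segment {T : Set ℝ} {x : ℝ → X} {γ : X} {a b t : ℝ}
    (h : HasDeltaDerivAt (segment T a b) x γ t) (hb : b ∈ T) (ht : t ∈ segment T a b)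
    (htb : t < b) : HasRightDeltaDerivAt T x γ t := by
  refine h.right_of_sigma_eq ht (sigma_segment ht.2.1 hb htb) ?_
  filter_upwards [self_mem_nhdsWithin, mem_nhdsWithin_of_mem_nhds (Iio_mem_nhds htb)]
    with s hs hsb using ⟨hs.1, ht.2.1.trans hs.2.le, hsb.le⟩

lemma HasRightDeltaDerivAt.sub {T : Set ℝ} {x y : ℝ → X} {γ δ : X} {t : ℝ}
    (hx : HasRightDeltaDerivAt T x γ t) (hy : HasRightDeltaDerivAt T y δ t) :
    HasRightDeltaDerivAt T (fun s => x s - y s) (γ - δ) t := by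
  refine ⟨fun h => ?_, fun h η hη => ?_⟩
  · simp only [hx.jump h, hy.jump h]; module
  · filter_upwards [hx.dense h (η / 2) (by positivity), hy.dense h (η / 2) (by positivity)]
      with s h1 h2
    have : x s - y s - (x t - y t) - (s - t) • (γ - δ)
        = (x s - x t - (s - t) • γ) - (y s - y t - (s - t) • δ) := by module
    rw [this]
    exact (norm_sub_le _ _).trans (by linarith)

lemma HasRightDeltaDerivAt.clm_comp {Y : Type*} [NormedAddCommGroup Y] [NormedSpace ℝ Y]
    {T : Set ℝ} {x : ℝ → X} {γ : X} {t : ℝ} (B : X →L[ℝ] Y)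
    (hx : HasRightDeltaDerivAt T x γ t) :
    HasRightDeltaDerivAt T (fun s => B (x s)) (B γ) t := by
  refine ⟨fun h => ?_, fun h η hη => ?_⟩
  · simp only [hx.jump h, map_add, map_smul]
  · have hpos : 0 < ‖B‖ + 1 := by positivity
    filter_upwards [hx.dense h (η / (‖B‖ + 1)) (by positivity), self_mem_nhdsWithin] with s h1 hs
    have h2 : 0 < s - t := sub_pos.2 hs.2
    have : B (x s) - B (x t) - (s - t) • B γ = B (x s - x t - (s - t) • γ) := by simp
    rw [this]
    calc _ ≤ ‖B‖ * ‖x s - x t - (s - t) • γ‖ := B.le_opNorm _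
      _ ≤ (‖B‖ + 1) * (η / (‖B‖ + 1) * (s - t)) := by gcongr; linarith
      _ = η * (s - t) := by field_simp

lemma hasRightDeltaDerivAt_const (T : Set ℝ) (c : X) (t : ℝ) :
    HasRightDeltaDerivAt T (fun _ => c) 0 t := by
  refine ⟨fun _ => by simp, fun _ η hη => ?_⟩
  filter_upwards [self_mem_nhdsWithin] with s hs
  have : 0 < s - t := sub_pos.2 hs.2
  simp only [sub_self, smul_zero, norm_zero]
  positivity

/-! ### Grönwall's inequality -/

/-- Grönwall's inequality on a time scale, in terms of right-sided difference quotients. -/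
theorem le_of_right_growth {T : Set ℝ} (hT : IsClosed T) {a b : ℝ} (ha : a ∈ T) {g : ℝ → ℝ}
    {L K : ℝ} (hg : ContinuousOn g (segment T a b)) (hL : 0 ≤ L) (hK : 0 ≤ K) (hga : 0 ≤ g a)
    (jump : ∀ t ∈ segment T a b, t < b → t < sigma T t →
      g (sigma T t) ≤ g t + (sigma T t - t) * (L * g t + K))
    (dense : ∀ t ∈ segment T a b, t < b → sigma T t = t → ∀ η > 0, ∀ᶠ s in 𝓝[T ∩ Ioi t] t,
      g s ≤ g t + (s - t) * (L * g t + K + η)) :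
    ∀ t ∈ segment T a b, g t ≤ (g a + K * (t - a)) * Real.exp (L * (t - a)) := by
  have main : ∀ η > 0, ∀ t ∈ segment T a b,
      g t ≤ (g a + (K + η) * (t - a)) * Real.exp (L * (t - a)) := by
    intro η hη
    have step : ∀ t s, a ≤ t → t ≤ s →
        g t ≤ (g a + (K + η) * (t - a)) * Real.exp (L * (t - a)) →
        g t + (s - t) * (L * g t + K + η) ≤
          (g a + (K + η) * (s - a)) * Real.exp (L * (s - a)) := by
      intro t s hat hts h
      have h0 : 0 ≤ s - t := sub_nonneg.2 hts
      have h1 : 0 ≤ t - a := sub_nonneg.2 hat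
      have e1 : 1 + L * (s - t) ≤ Real.exp (L * (s - t)) := by
        linarith [Real.add_one_le_exp (L * (s - t))]
      have e2 : 1 ≤ Real.exp (L * (s - a)) := Real.one_le_exp (by nlinarith)
      have e3 : Real.exp (L * (s - a)) = Real.exp (L * (t - a)) * Real.exp (L * (s - t)) := by
        rw [← Real.exp_add]; ring_nf
      set k := (g a + (K + η) * (t - a)) * Real.exp (L * (t - a)) with hk
      have hk0 : 0 ≤ k := by positivity
      calc g t + (s - t) * (L * g t + K + η)
          = g t * (1 + L * (s - t)) + (K + η) * (s - t) * 1 := by ring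
        _ ≤ k * Real.exp (L * (s - t)) + (K + η) * (s - t) * Real.exp (L * (s - a)) := by
          have : 0 ≤ 1 + L * (s - t) := by positivity
          gcongr
        _ = _ := by rw [hk, e3]; ring
    refine segment_induction hT ha (by simp) ?_ ?_ ?_
    · intro t ht htb hσ h
      refine (jump t ht htb hσ).trans (le_trans ?_ (step t _ ht.2.1 hσ.le h))
      have : 0 < sigma T t - t := sub_pos.2 hσ
      nlinarith
    · intro t ht htb hσ h
      filter_upwards [dense t ht htb hσ η hη, self_mem_nhdsWithin] with s hs hs'
      exact hs.trans (step t s ht.2.1 hs'.2.le h)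
    · intro t ht hcl h
      have : (𝓝[segment T a b ∩ Iio t] t).NeBot := mem_closure_iff_nhdsWithin_neBot.1 hcl
      refine le_of_tendsto_of_tendsto (b := 𝓝[segment T a b ∩ Iio t] t)
        ((hg t ht).mono_left (nhdsWithin_mono t inter_subset_left))
        (g := fun t => (g a + (K + η) * (t - a)) * Real.exp (L * (t - a))) ?_ ?_
      · exact (Continuous.tendsto (by fun_prop) t).mono_left nhdsWithin_le_nhds
      · filter_upwards [self_mem_nhdsWithin] with s hs using h s hs.1 hs.2
  intro t ht
  have hlim : Tendsto (fun η : ℝ => (g a + (K + η) * (t - a)) * Real.exp (L * (t - a)))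
      (𝓝[>] 0) (𝓝 ((g a + (K + 0) * (t - a)) * Real.exp (L * (t - a)))) :=
    (Continuous.tendsto (by fun_prop) 0).mono_left nhdsWithin_le_nhds
  rw [add_zero] at hlim
  refine ge_of_tendsto hlim ?_
  filter_upwards [self_mem_nhdsWithin] with η hη using main η hη t ht

theorem norm_le_of_right_deriv {T : Set ℝ} (hT : IsClosed T) {a b : ℝ} (ha : a ∈ T)
    {y y' : ℝ → X} {L K : ℝ} (hy : ContinuousOn y (segment T a b)) (hL : 0 ≤ L) (hK : 0 ≤ K)
    (hd : ∀ t ∈ segment T a b, t < b → HasRightDeltaDerivAt T y (y' t) t)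
    (hb : ∀ t ∈ segment T a b, t < b → ‖y' t‖ ≤ L * ‖y t‖ + K) :
    ∀ t ∈ segment T a b, ‖y t‖ ≤ (‖y a‖ + K * (t - a)) * Real.exp (L * (t - a)) := by
  refine le_of_right_growth hT ha hy.norm hL hK (norm_nonneg _) ?_ ?_
  · intro t ht htb hσ
    have h0 : 0 < sigma T t - t := sub_pos.2 hσ
    rw [(hd t ht htb).jump hσ]
    refine (norm_add_le _ _).trans ?_
    rw [norm_smul, Real.norm_of_nonneg h0.le]
    gcongr
    exact hb t ht htb
  · intro t ht htb hσ η hη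
    filter_upwards [(hd t ht htb).dense hσ η hη, self_mem_nhdsWithin] with s hs hs'
    have h0 : 0 < s - t := sub_pos.2 hs'.2
    have e : y s = y t + ((s - t) • y' t + (y s - y t - (s - t) • y' t)) := by abel
    calc ‖y s‖ ≤ ‖y t‖ + (‖(s - t) • y' t‖ + ‖y s - y t - (s - t) • y' t‖) := by
          nth_rewrite 1 [e]
          exact (norm_add_le _ _).trans (by gcongr; exact norm_add_le _ _)
      _ ≤ ‖y t‖ + ((s - t) * (L * ‖y t‖ + K) + η * (s - t)) := by
          rw [norm_smul, Real.norm_of_nonneg h0.le]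
          gcongr
          exact hb t ht htb
      _ = _ := by ring

theorem le_of_right_deriv_nonpos {T : Set ℝ} (hT : IsClosed T) {a b : ℝ} (ha : a ∈ T)
    {g g' : ℝ → ℝ} (hg : ContinuousOn g (segment T a b))
    (hd : ∀ t ∈ segment T a b, t < b → HasRightDeltaDerivAt T g (g' t) t)
    (hb : ∀ t ∈ segment T a b, t < b → g' t ≤ 0) :
    ∀ t ∈ segment T a b, g t ≤ g a := by
  have key := le_of_right_growth hT ha (g := fun t => g t - g a) (L := 0) (K := 0) (b := b)
    (hg.sub continuousOn_const) le_rfl le_rfl (by simp) ?_ ?_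
  · intro t ht
    simpa using key t ht
  · intro t ht htb hσ
    have h0 : 0 < sigma T t - t := sub_pos.2 hσ
    rw [(hd t ht htb).jump hσ, smul_eq_mul]
    nlinarith [hb t ht htb]
  · intro t ht htb hσ η hη
    filter_upwards [(hd t ht htb).dense hσ η hη, self_mem_nhdsWithin] with s hs hs'
    have h0 : 0 < s - t := sub_pos.2 hs'.2
    rw [Real.norm_eq_abs, smul_eq_mul] at hs
    nlinarith [hb t ht htb, (abs_le.1 hs).2]

/-! ### Solutions -/

lemma HasDeltaDerivAt.mono {J J' : Set ℝ} {x : ℝ → X} {γ : X} {t : ℝ}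
    (h : HasDeltaDerivAt J x γ t) (hsub : J' ⊆ J) (hσ : sigma J' t = sigma J t) :
    HasDeltaDerivAt J' x γ t := by
  intro ε hε
  obtain ⟨W, hW, h⟩ := h ε hε
  exact ⟨W, hW, fun s hs => by rw [hσ]; exact h s ⟨hs.1, hsub hs.2⟩⟩

lemma IsSolutionOn.segment {T : Set ℝ} {a b : ℝ} {F : ℝ → X → X} {x : ℝ → X}
    (h : IsSolutionOn (plus T a) F x) (hb : b ∈ T) : IsSolutionOn (segment T a b) F x := by
  refine ⟨h.1.mono (segment_subset_plus T a b), fun t ht ⟨s, hs, hts⟩ => ?_⟩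
  have htb : t < b := hts.trans_le hs.2.2
  exact (h.2 t ⟨ht.1, ht.2.1⟩ ⟨s, ⟨hs.1, hs.2.1⟩, hts⟩).mono (segment_subset_plus T a b)
    ((sigma_segment ht.2.1 hb htb).trans (sigma_plus ht.2.1).symm)

lemma IsSolutionOn.right_deriv {T : Set ℝ} {a b : ℝ} {F : ℝ → X → X} {x : ℝ → X}
    (h : IsSolutionOn (TimeScale.segment T a b) F x) (hb : b ∈ T) {t : ℝ}
    (ht : t ∈ TimeScale.segment T a b) (htb : t < b) :
    HasRightDeltaDerivAt T x (F t (x t)) t :=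
  (h.2 t ht ⟨b, ⟨hb, ht.2.1.trans htb.le, le_rfl⟩, htb⟩).right_of_segment hb ht htb

/-- Two solutions with values in a set where the right-hand side is Lipschitz coincide. -/
theorem IsSolutionOn.eqOn {T : Set ℝ} (hT : IsClosed T) {a b : ℝ} (ha : a ∈ T) (hb : b ∈ T)
    {F : ℝ → X → X} {x y : ℝ → X} (hx : IsSolutionOn (TimeScale.segment T a b) F x)
    (hy : IsSolutionOn (TimeScale.segment T a b) F y) {L : ℝ} (hL : 0 ≤ L)
    (hF : ∀ t ∈ TimeScale.segment T a b, ‖F t (x t) - F t (y t)‖ ≤ L * ‖x t - y t‖)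
    (h0 : x a = y a) : EqOn x y (TimeScale.segment T a b) := by
  intro t ht
  have := norm_le_of_right_deriv hT ha (hx.1.sub hy.1) hL le_rfl
    (fun t ht htb => (hx.right_deriv hb ht htb).sub (hy.right_deriv hb ht htb))
    (fun t ht _ => by simpa using hF t ht) t ht
  simp only [Pi.sub_apply, h0, sub_self, norm_zero, zero_mul, add_zero] at this
  exact sub_eq_zero.1 (norm_le_zero_iff.1 this)

end

section

variable {X : Type*} [NormedAddCommGroup X]

/-! ### rd-continuous functions -/

section Rd

variable {T : Set ℝ} {a b s t : ℝ}

lemma exists_gt_of_unbounded (hu : ¬ BddAbove T) (t : ℝ) : ∃ s ∈ T, t < s :=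
  not_bddAbove_iff.1 hu t

lemma RdContinuous.mono_plus {Y : Type*} [TopologicalSpace Y] {f : ℝ → Y}
    (h : RdContinuous (plus T a) f) (hab : a ≤ b) : RdContinuous (plus T b) f := by
  have hsub := plus_subset_plus T hab
  refine ⟨fun t ht hσ => ?_, fun t ht hcl => ?_⟩
  · rw [sigma_plus ht.2] at hσ
    exact (h.1 t (hsub ht) (by rwa [sigma_plus (hsub ht).2])).mono hsub
  · have hsub' : plus T b ∩ Iio t ⊆ plus T a ∩ Iio t := inter_subset_inter_left _ hsub
    obtain ⟨l, hl⟩ := h.2 t (hsub ht) (closure_mono hsub' hcl)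
    exact ⟨l, hl.mono_left (nhdsWithin_mono t hsub')⟩

lemma subset_insert_Iio_union_Ioi (S : Set ℝ) (t : ℝ) : S ⊆ insert t ((S ∩ Iio t) ∪ (S ∩ Ioi t)) := by
  intro s hs
  rcases lt_trichotomy s t with h | h | h
  · exact Or.inr (Or.inl ⟨hs, h⟩)
  · exact Or.inl h
  · exact Or.inr (Or.inr ⟨hs, h⟩)

lemma eventually_false_of_lt_sigma (h : t < sigma T t) : ∀ᶠ _s in 𝓝[T ∩ Ioi t] t, False := by
  filter_upwards [self_mem_nhdsWithin, mem_nhdsWithin_of_mem_nhds (Iio_mem_nhds h)] with s hs hs'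
  exact absurd (sigma_le hs.1 hs.2) (not_le.2 hs')

lemma RdContinuous.exists_norm_le_nhds (hu : ¬ BddAbove T) {g : ℝ → X}
    (hg : RdContinuous (plus T a) g) (ht : t ∈ plus T a) :
    ∃ M, ∀ᶠ s in 𝓝[plus T a] t, ‖g s‖ ≤ M := by
  have hl : ∃ M, ∀ᶠ s in 𝓝[plus T a ∩ Iio t] t, ‖g s‖ ≤ M := by
    by_cases hcl : t ∈ closure (plus T a ∩ Iio t)
    · obtain ⟨l, hl⟩ := hg.2 t ht hcl
      exact ⟨‖l‖ + 1, hl.norm.eventually_le_const (lt_add_one _)⟩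
    · refine ⟨0, ?_⟩
      rw [mem_closure_iff_nhdsWithin_neBot, not_neBot] at hcl
      simp [hcl]
  have hr : ∃ M, ∀ᶠ s in 𝓝[plus T a ∩ Ioi t] t, ‖g s‖ ≤ M := by
    obtain ⟨z, hz, htz⟩ := exists_gt_of_unbounded hu t
    rcases (le_sigma hz htz).eq_or_lt with h | h
    · refine ⟨‖g t‖ + 1, Tendsto.eventually_le_const (lt_add_one _) (Tendsto.norm ?_)⟩
      exact (hg.1 t ht (by rw [sigma_plus ht.2, ← h])).mono inter_subset_left
    · refine ⟨0, ?_⟩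
      have : t < sigma (plus T a) t := by rwa [sigma_plus ht.2]
      exact (eventually_false_of_lt_sigma this).mono fun _ h => h.elim
  obtain ⟨M₁, h₁⟩ := hl
  obtain ⟨M₂, h₂⟩ := hr
  refine ⟨max ‖g t‖ (max M₁ M₂), ?_⟩
  refine Filter.Eventually.filter_mono (nhdsWithin_mono t (subset_insert_Iio_union_Ioi _ t)) ?_
  rw [nhdsWithin_insert, eventually_sup, nhdsWithin_union, eventually_sup]
  refine ⟨by simp, h₁.mono fun s hs => ?_, h₂.mono fun s hs => ?_⟩
  · exact hs.trans ((le_max_left _ _).trans (le_max_right _ _))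
  · exact hs.trans ((le_max_right _ _).trans (le_max_right _ _))

/-- rd-continuous functions are bounded on bounded pieces of the time scale. -/
theorem RdContinuous.exists_norm_le (hT : IsClosed T) (hu : ¬ BddAbove T) {g : ℝ → X}
    (hg : RdContinuous (plus T a) g) (b : ℝ) : ∃ M, ∀ t ∈ segment T a b, ‖g t‖ ≤ M := by
  refine (isCompact_segment hT a b).induction_on (p := fun s => ∃ M, ∀ t ∈ s, ‖g t‖ ≤ M)
    ⟨0, by simp⟩ (fun s t hst ⟨M, hM⟩ => ⟨M, fun z hz => hM z (hst hz)⟩) ?_ ?_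
  · rintro s t ⟨M, hM⟩ ⟨N, hN⟩
    refine ⟨max M N, fun z hz => hz.elim (fun h => ?_) fun h => ?_⟩
    · exact (hM z h).trans (le_max_left _ _)
    · exact (hN z h).trans (le_max_right _ _)
  · intro t ht
    obtain ⟨M, hM⟩ := hg.exists_norm_le_nhds hu (segment_subset_plus T a b ht)
    exact ⟨{s | ‖g s‖ ≤ M}, nhdsWithin_mono t (segment_subset_plus T a b) hM, M, fun s hs => hs⟩

end Rd

/-! ### Projection onto the time scale and the Cauchy integral -/

/-- The largest point of `[a, ∞) ∩ T` not exceeding `s` (and `a` for `s < a`). -/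
def proj (T : Set ℝ) (a s : ℝ) : ℝ := sSup (segment T a (max a s))

section Proj

variable {T : Set ℝ} {a b s t : ℝ}

lemma bddAbove_segment (T : Set ℝ) (a b : ℝ) : BddAbove (segment T a b) := ⟨b, fun _ h => h.2.2⟩

lemma proj_mem (hT : IsClosed T) (ha : a ∈ T) (s : ℝ) : proj T a s ∈ segment T a (max a s) :=
  (isCompact_segment hT a _).sSup_mem ⟨a, ha, le_rfl, le_max_left _ _⟩

lemma proj_mem_plus (hT : IsClosed T) (ha : a ∈ T) (s : ℝ) : proj T a s ∈ plus T a :=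
  segment_subset_plus _ _ _ (proj_mem hT ha s)

lemma proj_le (hT : IsClosed T) (ha : a ∈ T) (h : a ≤ s) : proj T a s ≤ s := by
  simpa [h] using (proj_mem hT ha s).2.2

lemma le_proj (ht : t ∈ plus T a) (hts : t ≤ s) : t ≤ proj T a s :=
  le_csSup (bddAbove_segment _ _ _) ⟨ht.1, ht.2, hts.trans (le_max_right _ _)⟩

lemma proj_eq_of_lt_sigma (hT : IsClosed T) (ha : a ∈ T) (ht : t ∈ plus T a) (hts : t ≤ s)
    (h : s < sigma T t) : proj T a s = t := by
  refine le_antisymm ?_ (le_proj ht hts)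
  by_contra! hlt
  have := sigma_le (proj_mem hT ha s).1 hlt
  exact absurd (this.trans (proj_le hT ha (le_trans ht.2 hts))) (not_le.2 h)

lemma proj_of_le (hT : IsClosed T) (ha : a ∈ T) (h : s ≤ a) : proj T a s = a := by
  have := proj_mem hT ha s
  rw [max_eq_left h] at this
  exact le_antisymm this.2.2 this.2.1

lemma RdContinuous.continuousWithinAt_comp_proj (hT : IsClosed T) (hu : ¬ BddAbove T)
    (ha : a ∈ T) {g : ℝ → X} (hg : RdContinuous (plus T a) g) (s : ℝ) :
    ContinuousWithinAt (fun τ => g (proj T a τ)) (Ioi s) s := by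
  rcases lt_or_ge s a with hsa | has
  · refine ContinuousWithinAt.congr_of_eventuallyEq
      (continuousWithinAt_const (b := g a)) ?_ (by rw [proj_of_le hT ha hsa.le])
    filter_upwards [mem_nhdsWithin_of_mem_nhds (Iio_mem_nhds hsa)] with τ hτ
    rw [proj_of_le hT ha (mem_Iio.1 hτ).le]
  set t := proj T a s with ht
  have htS : t ∈ plus T a := proj_mem_plus hT ha s
  have hts : t ≤ s := proj_le hT ha has
  obtain ⟨z, hz, htz⟩ := exists_gt_of_unbounded hu t
  rcases (le_sigma hz htz).eq_or_lt with h | h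
  · have hst : t = s := by
      by_contra hne
      have hlt : t < s := lt_of_le_of_ne hts hne
      obtain ⟨y, hy, hty, hys⟩ := exists_mem_Ioo_of_sigma_lt hz htz (h ▸ hlt)
      exact absurd (le_proj ⟨hy, le_trans htS.2 hty.le⟩ hys.le) (not_le.2 hty)
    have hc := hg.1 t htS (by rw [sigma_plus htS.2, ← h])
    have hproj : Tendsto (proj T a) (𝓝[>] s) (𝓝[plus T a] t) := by
      refine tendsto_nhdsWithin_of_tendsto_nhds_of_eventually_within _ ?_
        (Eventually.of_forall fun τ => proj_mem_plus hT ha τ)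
      refine tendsto_of_tendsto_of_tendsto_of_le_of_le' (tendsto_const_nhds (x := t))
        (h := fun τ => τ) (hst ▸ tendsto_id.mono_left nhdsWithin_le_nhds) ?_ ?_
      · filter_upwards [self_mem_nhdsWithin] with τ hτ
        exact le_proj htS (hts.trans (mem_Ioi.1 hτ).le)
      · filter_upwards [self_mem_nhdsWithin] with τ hτ
        exact proj_le hT ha (has.trans (mem_Ioi.1 hτ).le)
    have := hc.tendsto.comp hproj
    rw [ContinuousWithinAt, ← ht]
    exact this
  · have hsσ : s < sigma T t := by
      by_contra! hle
      exact absurd (le_proj ⟨sigma_mem hT hz htz, le_trans htS.2 h.le⟩ hle) (not_le.2 h)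
    refine ContinuousWithinAt.congr_of_eventuallyEq
      (continuousWithinAt_const (b := g t)) ?_ rfl
    filter_upwards [self_mem_nhdsWithin, mem_nhdsWithin_of_mem_nhds (Iio_mem_nhds hsσ)]
      with τ hτ hτ'
    rw [proj_eq_of_lt_sigma hT ha htS (hts.trans (mem_Ioi.1 hτ).le) hτ']

end Proj

/-- Right-continuous functions are strongly measurable. -/
theorem stronglyMeasurable_of_right_continuous {h : ℝ → X}
    (hc : ∀ s, ContinuousWithinAt h (Ioi s) s) : MeasureTheory.StronglyMeasurable h := by
  refine stronglyMeasurable_of_tendsto (u := atTop)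
    (f := fun (n : ℕ) s => (fun k : ℤ => h ((k + 1 : ℝ) / (n + 1 : ℝ))) ⌊((n : ℝ) + 1) * s⌋) ?_ ?_
  · intro n
    have hk : MeasureTheory.StronglyMeasurable (fun k : ℤ => h ((k + 1 : ℝ) / (n + 1 : ℝ))) :=
      MeasureTheory.StronglyMeasurable.of_discrete
    exact hk.comp_measurable (by fun_prop)
  · rw [tendsto_pi_nhds]
    intro s
    have hlim : Tendsto (fun n : ℕ => ((⌊((n : ℝ) + 1) * s⌋ : ℝ) + 1) / ((n : ℝ) + 1)) atTop
        (𝓝[>] s) := by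
      have hgt : ∀ n : ℕ, s < ((⌊((n : ℝ) + 1) * s⌋ : ℝ) + 1) / ((n : ℝ) + 1) := fun n => by
        rw [lt_div_iff₀ (by positivity), mul_comm]
        exact Int.lt_floor_add_one _
      refine tendsto_nhdsWithin_of_tendsto_nhds_of_eventually_within _ ?_
        (Eventually.of_forall hgt)
      refine tendsto_of_tendsto_of_tendsto_of_le_of_le (tendsto_const_nhds (x := s))
        (h := fun n : ℕ => s + 1 / ((n : ℝ) + 1)) ?_ (fun n => (hgt n).le) ?_
      · simpa using (tendsto_one_div_add_atTop_nhds_zero_nat (𝕜 := ℝ)).const_add s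
      · intro n
        have hp : (0 : ℝ) < (n : ℝ) + 1 := by positivity
        have := Int.floor_le (((n : ℝ) + 1) * s)
        simp only
        rw [div_le_iff₀ hp]
        field_simp
        linarith
    exact (hc s).tendsto.comp hlim

section Integral

variable {T : Set ℝ} {a b s t : ℝ} {g : ℝ → X}

lemma RdContinuous.intervalIntegrable_comp_proj (hT : IsClosed T) (hu : ¬ BddAbove T)
    (ha : a ∈ T) (hg : RdContinuous (plus T a) g) (x y : ℝ) :
    IntervalIntegrable (fun τ => g (proj T a τ)) MeasureTheory.volume x y := by
  obtain ⟨M, hM⟩ := hg.exists_norm_le hT hu (max a (max x y))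
  have hmeas := stronglyMeasurable_of_right_continuous
    (hg.continuousWithinAt_comp_proj hT hu ha)
  rw [intervalIntegrable_iff]
  refine MeasureTheory.Measure.integrableOn_of_bounded (M := M)
    measure_Ioc_lt_top.ne hmeas.aestronglyMeasurable ?_
  refine (MeasureTheory.ae_restrict_iff' measurableSet_uIoc).2 (Eventually.of_forall ?_)
  intro τ hτ
  have h := proj_mem hT ha τ
  exact hM _ ⟨h.1, h.2.1, h.2.2.trans (max_le_max le_rfl hτ.2)⟩

/-- The fundamental theorem of calculus for the Cauchy integral on a time scale. -/
theorem RdContinuous.hasDeltaDerivAt_integral [NormedSpace ℝ X] [CompleteSpace X]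
    (hT : IsClosed T) (hu : ¬ BddAbove T) (ha : a ∈ T) (hg : RdContinuous (plus T a) g) (x₀ : X)
    (ht : t ∈ plus T a) :
    HasDeltaDerivAt (plus T a) (fun s => x₀ + ∫ τ in a..s, g (proj T a τ)) (g t) t := by
  have hint := hg.intervalIntegrable_comp_proj hT hu ha
  have hcont : Continuous fun s => ∫ τ in a..s, g (proj T a τ) :=
    intervalIntegral.continuous_primitive hint a
  obtain ⟨z, hz, htz⟩ := exists_gt_of_unbounded hu t
  intro η hη
  rw [sigma_plus ht.2]
  rcases (le_sigma hz htz).eq_or_lt with h | h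
  · rw [← h]
    obtain ⟨δ, hδ, hδg⟩ := Metric.continuousWithinAt_iff.1
      (hg.1 t ht (by rw [sigma_plus ht.2, ← h])) η hη
    refine ⟨Metric.ball t δ, Metric.ball_mem_nhds t hδ, fun s hs => ?_⟩
    have e : (x₀ + ∫ τ in a..t, g (proj T a τ)) - (x₀ + ∫ τ in a..s, g (proj T a τ))
        - (t - s) • g t = ∫ τ in s..t, (g (proj T a τ) - g t) := by
      rw [intervalIntegral.integral_sub (hint s t) (by simp), intervalIntegral.integral_const,
        ← intervalIntegral.integral_interval_sub_left (hint a t) (hint a s)]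
      abel
    rw [e]
    refine intervalIntegral.norm_integral_le_of_norm_le_const fun τ hτ => ?_
    rw [← dist_eq_norm]
    refine (hδg (proj_mem_plus hT ha τ) ?_).le
    have hmin : min s t ∈ plus T a := by
      rcases min_choice s t with h' | h' <;> rw [h'] <;> [exact hs.2; exact ht]
    have h1 : min s t ≤ proj T a τ := le_proj hmin hτ.1.le
    have h2 : proj T a τ ≤ max s t :=
      (proj_le hT ha (le_trans hmin.2 hτ.1.le)).trans hτ.2
    have h3 : |s - t| < δ := by simpa [Real.dist_eq] using hs.1
    rw [Real.dist_eq]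
    rw [abs_lt] at h3 ⊢
    constructor <;> rcases le_total s t with h' | h' <;> simp [h'] at h1 h2 <;> linarith
  · have e1 : ∫ τ in t..sigma T t, g (proj T a τ) = (sigma T t - t) • g t := by
      rw [← intervalIntegral.integral_const]
      refine intervalIntegral.integral_congr_Ioo_of_le h.le fun τ hτ => ?_
      rw [proj_eq_of_lt_sigma hT ha ht hτ.1.le hτ.2]
    have e2 : ∀ s, (x₀ + ∫ τ in a..sigma T t, g (proj T a τ)) -
        (x₀ + ∫ τ in a..s, g (proj T a τ)) - (sigma T t - s) • g t
        = (∫ τ in a..t, g (proj T a τ)) - (∫ τ in a..s, g (proj T a τ)) - (t - s) • g t := by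
      intro s
      rw [← intervalIntegral.integral_add_adjacent_intervals (hint a t) (hint t (sigma T t)), e1]
      module
    have hlim1 : Tendsto (fun s => ‖(∫ τ in a..t, g (proj T a τ)) -
        (∫ τ in a..s, g (proj T a τ)) - (t - s) • g t‖) (𝓝 t) (𝓝 0) := by
      have : Continuous fun s => ‖(∫ τ in a..t, g (proj T a τ)) -
        (∫ τ in a..s, g (proj T a τ)) - (t - s) • g t‖ := by fun_prop
      simpa using this.tendsto t
    have hlim2 : Tendsto (fun s => η * |sigma T t - s|) (𝓝 t) (𝓝 (η * |sigma T t - t|)) :=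
      Continuous.tendsto (by fun_prop) t
    have hpos : 0 < η * |sigma T t - t| := mul_pos hη (abs_pos.2 (sub_pos.2 h).ne')
    refine ⟨_, hlim1.eventually_lt hlim2 hpos, fun s hs => ?_⟩
    rw [e2]
    exact (show _ < _ from hs.1).le

end Integral

end

section

variable {X : Type*} [NormedAddCommGroup X]

/-! ### Global existence of solutions -/

section Picard

variable {T : Set ℝ} {a : ℝ} {F : ℝ → X → X}

lemma RdContinuous.comp_continuousOn (hrd : ∀ x, RdContinuous (plus T a) fun t => F t x)
    (hLip : ∀ b, ∃ L : NNReal, ∀ t ∈ segment T a b, LipschitzWith L (F t)) {x : ℝ → X}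
    (hx : ContinuousOn x (plus T a)) : RdContinuous (plus T a) fun t => F t (x t) := by
  have key : ∀ t ∈ plus T a, ∀ l ≤ 𝓝[plus T a] t, ∀ c, Tendsto (fun s => F s (x t)) l (𝓝 c) →
      Tendsto (fun s => F s (x s)) l (𝓝 c) := by
    intro t ht l hl c hc
    obtain ⟨L, hL⟩ := hLip (t + 1)
    have h0 : Tendsto (fun s => F s (x s) - F s (x t)) l (𝓝 0) := by
      have hx' : Tendsto (fun s => (L : ℝ) * ‖x s - x t‖) l (𝓝 ((L : ℝ) * ‖x t - x t‖)) :=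
        (((hx t ht).mono_left hl).sub_const (x t)).norm.const_mul (L : ℝ)
      rw [sub_self, norm_zero, mul_zero] at hx'
      refine squeeze_zero_norm' ?_ hx'
      have h1 : ∀ᶠ s in 𝓝[plus T a] t, s ∈ segment T a (t + 1) := by
        filter_upwards [self_mem_nhdsWithin,
          mem_nhdsWithin_of_mem_nhds (Iio_mem_nhds (lt_add_one t))] with s hs hs'
        exact ⟨hs.1, hs.2, (mem_Iio.1 hs').le⟩
      filter_upwards [hl h1] with s hs using (hL s hs).norm_sub_le _ _
    simpa using h0.add hc
  refine ⟨fun t ht hσ => ?_, fun t ht hcl => ?_⟩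
  · exact key t ht _ le_rfl _ ((hrd (x t)).1 t ht hσ)
  · obtain ⟨c, hc⟩ := (hrd (x t)).2 t ht hcl
    exact ⟨c, key t ht _ (nhdsWithin_mono t inter_subset_left) c hc⟩

variable [NormedSpace ℝ X]

/-- Picard iterates of `x^Δ = F(t, x)`, `x(a) = x₀`. -/
def picardIter (T : Set ℝ) (F : ℝ → X → X) (a : ℝ) (x₀ : X) : ℕ → ℝ → X
  | 0 => fun _ => x₀
  | n + 1 => fun t => x₀ + ∫ τ in a..t, F (proj T a τ) (picardIter T F a x₀ n (proj T a τ))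

lemma continuous_picard (hT : IsClosed T) (hu : ¬ BddAbove T) (ha : a ∈ T)
    (hrd : ∀ x, RdContinuous (plus T a) fun t => F t x)
    (hLip : ∀ b, ∃ L : NNReal, ∀ t ∈ segment T a b, LipschitzWith L (F t)) (x₀ : X) {x : ℝ → X}
    (hx : ContinuousOn x (plus T a)) :
    Continuous fun t => x₀ + ∫ τ in a..t, F (proj T a τ) (x (proj T a τ)) :=
  continuous_const.add (intervalIntegral.continuous_primitive
    ((RdContinuous.comp_continuousOn hrd hLip hx).intervalIntegrable_comp_proj hT hu ha) a)

lemma continuous_picardIter (hT : IsClosed T) (hu : ¬ BddAbove T) (ha : a ∈ T)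
    (hrd : ∀ x, RdContinuous (plus T a) fun t => F t x)
    (hLip : ∀ b, ∃ L : NNReal, ∀ t ∈ segment T a b, LipschitzWith L (F t)) (x₀ : X) :
    ∀ n, Continuous (picardIter T F a x₀ n)
  | 0 => continuous_const
  | n + 1 => continuous_picard hT hu ha hrd hLip x₀
      (continuous_picardIter hT hu ha hrd hLip x₀ n).continuousOn

lemma norm_picard_sub_le (hT : IsClosed T) (hu : ¬ BddAbove T) (ha : a ∈ T)
    (hrd : ∀ x, RdContinuous (plus T a) fun t => F t x)
    (hLip : ∀ b, ∃ L : NNReal, ∀ t ∈ segment T a b, LipschitzWith L (F t)) (x₀ : X)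
    {x y : ℝ → X} (hx : ContinuousOn x (plus T a)) (hy : ContinuousOn y (plus T a))
    {b L D : ℝ} (hL : 0 < L) (hD : 0 ≤ D)
    (hF : ∀ t ∈ segment T a b, ∀ p q, ‖F t p - F t q‖ ≤ L * ‖p - q‖)
    (hxy : ∀ t ∈ segment T a b, ‖x t - y t‖ ≤ D * Real.exp (2 * L * (t - a)))
    {t : ℝ} (ht : t ∈ Icc a b) :
    ‖(x₀ + ∫ τ in a..t, F (proj T a τ) (x (proj T a τ))) -
      (x₀ + ∫ τ in a..t, F (proj T a τ) (y (proj T a τ)))‖ ≤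
      D / 2 * Real.exp (2 * L * (t - a)) := by
  have hix := (RdContinuous.comp_continuousOn hrd hLip hx).intervalIntegrable_comp_proj
    hT hu ha a t
  have hiy := (RdContinuous.comp_continuousOn hrd hLip hy).intervalIntegrable_comp_proj
    hT hu ha a t
  rw [add_sub_add_left_eq_sub, ← intervalIntegral.integral_sub hix hiy]
  have hderiv : ∀ τ ∈ uIcc a t, HasDerivAt (fun τ => D / 2 * Real.exp (2 * L * (τ - a)))
      (L * D * Real.exp (2 * L * (τ - a))) τ := by
    intro τ _
    have := ((((hasDerivAt_id' τ).sub_const a).const_mul (2 * L)).exp).const_mul (D / 2)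
    exact this.congr_deriv (by ring)
  have hcont : Continuous fun τ => L * D * Real.exp (2 * L * (τ - a)) := by fun_prop
  have hval := intervalIntegral.integral_eq_sub_of_hasDerivAt hderiv
    (hcont.intervalIntegrable a t)
  calc _ ≤ ∫ τ in a..t, L * D * Real.exp (2 * L * (τ - a)) := by
        refine intervalIntegral.norm_integral_le_of_norm_le ht.1 ?_
          (hcont.intervalIntegrable a t)
        refine Eventually.of_forall fun τ hτ => ?_
        have hp := proj_mem_plus hT ha τ
        have hpτ := proj_le hT ha hτ.1.le
        have hps : proj T a τ ∈ segment T a b := ⟨hp.1, hp.2, hpτ.trans (hτ.2.trans ht.2)⟩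
        calc _ ≤ L * ‖x (proj T a τ) - y (proj T a τ)‖ := hF _ hps _ _
          _ ≤ L * (D * Real.exp (2 * L * (proj T a τ - a))) := by gcongr; exact hxy _ hps
          _ ≤ L * (D * Real.exp (2 * L * (τ - a))) := by gcongr
          _ = _ := by ring
    _ = D / 2 * Real.exp (2 * L * (t - a)) - D / 2 := by rw [hval]; simp
    _ ≤ _ := by linarith

/-- Global existence of solutions of equations with an rd-continuous right-hand side which is
Lipschitz in the space variable, uniformly on bounded pieces of the time scale. -/
theorem exists_solution [CompleteSpace X] (hT : IsClosed T) (hu : ¬ BddAbove T) (ha : a ∈ T)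
    (hrd : ∀ x, RdContinuous (plus T a) fun t => F t x)
    (hLip : ∀ b, ∃ L : NNReal, ∀ t ∈ segment T a b, LipschitzWith L (F t)) (x₀ : X) :
    ∃ x : ℝ → X, IsSolutionOn (plus T a) F x ∧ x a = x₀ := by
  set p := picardIter T F a x₀ with hp
  have hpc := continuous_picardIter hT hu ha hrd hLip x₀
  have bound : ∀ b, ∃ L : ℝ, ∃ D : ℝ, 0 < L ∧ 0 ≤ D ∧
      (∀ t ∈ segment T a b, ∀ p q, ‖F t p - F t q‖ ≤ L * ‖p - q‖) ∧
      ∀ n : ℕ, ∀ t ∈ Icc a b, ‖p (n + 1) t - p n t‖ ≤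
        D / 2 ^ n * Real.exp (2 * L * (t - a)) := by
    intro b
    obtain ⟨L, hL⟩ := hLip b
    obtain ⟨D, hD⟩ := (isCompact_Icc (a := a) (b := b)).exists_bound_of_continuousOn
      (f := fun t => p 1 t - p 0 t) ((hpc 1).sub (hpc 0)).continuousOn
    have hF : ∀ t ∈ segment T a b, ∀ p q, ‖F t p - F t q‖ ≤ (L + 1) * ‖p - q‖ := by
      intro t ht p q
      refine ((hL t ht).norm_sub_le p q).trans ?_
      gcongr
      linarith
    refine ⟨L + 1, |D|, by positivity, abs_nonneg D, hF, fun n => ?_⟩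
    induction n with
    | zero =>
      intro t ht
      have h1 : 1 ≤ Real.exp (2 * ((L : ℝ) + 1) * (t - a)) :=
        Real.one_le_exp (mul_nonneg (by positivity) (sub_nonneg.2 ht.1))
      calc _ ≤ D := hD t ht
        _ ≤ |D| * 1 := by rw [mul_one]; exact le_abs_self D
        _ ≤ |D| / 2 ^ 0 * Real.exp (2 * ((L : ℝ) + 1) * (t - a)) := by
          rw [pow_zero, div_one]; gcongr
    | succ n ih =>
      intro t ht
      have := norm_picard_sub_le hT hu ha hrd hLip x₀ (hpc (n + 1)).continuousOn
        (hpc n).continuousOn (by positivity : (0 : ℝ) < L + 1)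
        (by positivity : 0 ≤ |D| / 2 ^ n) hF (fun s hs => ih s hs.2) ht
      rw [pow_succ, ← div_div]
      exact this
  have hlim : ∀ t, ∃ y, a ≤ t → Tendsto (fun n => p n t) atTop (𝓝 y) := by
    intro t
    by_cases hat : a ≤ t
    · obtain ⟨L, D, _, _, _, h⟩ := bound t
      have : CauchySeq fun n => p n t :=
        cauchySeq_of_le_geometric_two (C := 2 * (D * Real.exp (2 * L * (t - a)))) fun n => by
          rw [dist_comm, dist_eq_norm]
          refine (h n t ⟨hat, le_rfl⟩).trans (le_of_eq ?_)
          ring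
      obtain ⟨y, hy⟩ := cauchySeq_tendsto_of_complete this
      exact ⟨y, fun _ => hy⟩
    · exact ⟨0, fun h => absurd h hat⟩
  choose x hx using hlim
  have hunif : ∀ b, ∃ C : ℝ, 0 ≤ C ∧ ∀ n : ℕ, ∀ t ∈ Icc a b, ‖p n t - x t‖ ≤ C / 2 ^ n := by
    intro b
    obtain ⟨L, D, hL, hD, _, h⟩ := bound b
    refine ⟨2 * (D * Real.exp (2 * L * (b - a))), by positivity, fun n t ht => ?_⟩
    rw [← dist_eq_norm]
    refine dist_le_of_le_geometric_two_of_tendsto (f := fun n => p n t) (fun n => ?_)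
      (hx t ht.1) n
    rw [dist_comm, dist_eq_norm]
    refine (h n t ht).trans ?_
    calc D / 2 ^ n * Real.exp (2 * L * (t - a)) ≤ D / 2 ^ n * Real.exp (2 * L * (b - a)) := by
          gcongr; exact ht.2
      _ = _ := by ring
  have hgeom : ∀ C : ℝ, Tendsto (fun n : ℕ => C / 2 ^ n) atTop (𝓝 0) := fun C => by
    have := (tendsto_pow_atTop_nhds_zero_of_lt_one (r := (1 / 2 : ℝ)) (by norm_num)
      (by norm_num)).const_mul C
    simpa [div_eq_mul_inv] using this
  have hxc : ∀ b, ContinuousOn x (Icc a b) := by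
    intro b
    obtain ⟨C, _, h⟩ := hunif b
    refine TendstoUniformlyOn.continuousOn (F := p) (p := atTop) ?_
      (Frequently.of_forall fun n => (hpc n).continuousOn)
    rw [Metric.tendstoUniformlyOn_iff]
    intro η hη
    filter_upwards [(hgeom C).eventually_lt_const hη] with n hn t ht
    rw [dist_comm, dist_eq_norm]
    exact (h n t ht).trans_lt hn
  have hxS : ContinuousOn x (plus T a) := by
    intro t ht
    have h1 : ContinuousWithinAt x (Icc a (t + 1)) t := hxc (t + 1) t ⟨ht.2, by linarith⟩
    refine h1.mono_of_mem_nhdsWithin ?_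
    filter_upwards [self_mem_nhdsWithin,
      mem_nhdsWithin_of_mem_nhds (Iio_mem_nhds (lt_add_one t))] with s hs hs'
    exact ⟨hs.2, (mem_Iio.1 hs').le⟩
  have hfix : ∀ t, a ≤ t → x t = x₀ + ∫ τ in a..t, F (proj T a τ) (x (proj T a τ)) := by
    intro t hat
    obtain ⟨L, -, hL, -, hF, -⟩ := bound t
    obtain ⟨C, hC, h⟩ := hunif t
    refine tendsto_nhds_unique ((tendsto_add_atTop_iff_nat 1).2 (hx t hat)) ?_
    rw [tendsto_iff_norm_sub_tendsto_zero]
    refine squeeze_zero (fun _ => norm_nonneg _) (fun n => ?_)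
      (hgeom (C / 2 * Real.exp (2 * L * (t - a))))
    have := norm_picard_sub_le hT hu ha hrd hLip x₀ (hpc n).continuousOn hxS hL
      (by positivity : 0 ≤ C / 2 ^ n) hF (fun s hs => ?_) (t := t) ⟨hat, le_rfl⟩
    · refine this.trans (le_of_eq ?_)
      ring
    · refine (h n s hs.2).trans (le_mul_of_one_le_right (by positivity) ?_)
      exact Real.one_le_exp (mul_nonneg (by positivity) (sub_nonneg.2 hs.2.1))
  refine ⟨x, ⟨hxS, fun t ht hlater => ?_⟩, by rw [hfix a le_rfl]; simp⟩
  have hd := (RdContinuous.comp_continuousOn hrd hLip hxS).hasDeltaDerivAt_integral hT hu ha x₀ ht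
  intro ε hε
  obtain ⟨W, hW, h⟩ := hd ε hε
  refine ⟨W, hW, fun s hs => ?_⟩
  obtain ⟨z, hz, htz⟩ := hlater
  rw [hfix _ (le_trans ht.2 (le_sigma hz htz)), hfix s hs.2.2]
  exact h s hs

end Picard

/-! ### Antiderivatives and the generalized exponential -/

section Antiderivative

variable {T : Set ℝ} {a : ℝ}

lemma RdContinuous.exists_antideriv (hT : IsClosed T) (hu : ¬ BddAbove T) (ha : a ∈ T)
    {f : ℝ → ℝ} (hf : RdContinuous (plus T a) f) :
    ∃ F : ℝ → ℝ, IsDeltaAntideriv (plus T a) f F :=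
  ⟨_, fun _ ht => hf.hasDeltaDerivAt_integral hT hu ha 0 ht⟩

lemma RdContinuous.exists_deltaIntegral_eq (hT : IsClosed T) (hu : ¬ BddAbove T) (ha : a ∈ T)
    {f : ℝ → ℝ} (hf : RdContinuous (plus T a) f) :
    ∃ F : ℝ → ℝ, IsDeltaAntideriv (plus T a) f F ∧
      ∀ s t, deltaIntegral (plus T a) f s t = F t - F s := by
  have h := hf.exists_antideriv hT hu ha
  exact ⟨h.choose, h.choose_spec, fun s t => by rw [deltaIntegral, dif_pos h]⟩

lemma HasDeltaDerivAt.continuousWithinAt [NormedSpace ℝ X] {S : Set ℝ} {x : ℝ → X} {γ : X} {t : ℝ}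
    (h : HasDeltaDerivAt S x γ t) (ht : t ∈ S) : ContinuousWithinAt x S t := by
  rw [Metric.continuousWithinAt_iff']
  intro η hη
  set m := |sigma S t - t| with hm
  obtain ⟨W, hW, hWs⟩ := h (η / (2 * (m + 1))) (by positivity)
  have hγ : Tendsto (fun s => ‖(t - s) • γ‖) (𝓝 t) (𝓝 0) := by
    have : Continuous fun s => ‖(t - s) • γ‖ := by fun_prop
    simpa using this.tendsto t
  have hone : ∀ᶠ s in 𝓝 t, |sigma S t - s| < m + 1 :=
    (Continuous.tendsto (f := fun s => |sigma S t - s|) (by fun_prop) t).eventually_lt_const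
      (lt_add_one _)
  filter_upwards [self_mem_nhdsWithin, mem_nhdsWithin_of_mem_nhds hW,
    nhdsWithin_le_nhds (hγ.eventually_lt_const (half_pos hη)), nhdsWithin_le_nhds hone]
    with s hs hsW h1 h2
  have h3 := hWs s ⟨hsW, hs⟩
  have e : x t - x s = (x (sigma S t) - x s - (sigma S t - s) • γ) + (t - s) • γ := by
    rw [h.apply_sigma ht]; module
  rw [dist_comm, dist_eq_norm, e]
  calc _ ≤ η / (2 * (m + 1)) * |sigma S t - s| + ‖(t - s) • γ‖ :=
        (norm_add_le _ _).trans (by gcongr)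
    _ < η / (2 * (m + 1)) * (m + 1) + η / 2 := by
        have : 0 < η / (2 * (m + 1)) := by positivity
        gcongr
    _ = η := by
        have : m + 1 ≠ 0 := by positivity
        field_simp
        norm_num

lemma IsDeltaAntideriv.continuousOn {S : Set ℝ} {f F : ℝ → ℝ} (h : IsDeltaAntideriv S f F) :
    ContinuousOn F S := fun t ht => (h t ht).continuousWithinAt ht

lemma abs_xi_sub_le {h z : ℝ} (hh : |z * h| ≤ 1 / 2) : |xi h z - z| ≤ 2 * z ^ 2 * |h| := by
  unfold xi
  split_ifs with h0
  · simp [h0]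
  · have h1 : |(-(z * h))| < 1 := by rw [abs_neg]; linarith
    have key := Real.abs_log_sub_add_sum_range_le h1 1
    simp only [Finset.range_one, Finset.sum_singleton, zero_add, pow_one, Nat.cast_zero, div_one,
      sub_neg_eq_add, abs_neg] at key
    have hle : |z * h| ^ 2 / (1 - |z * h|) ≤ 2 * (z ^ 2 * h ^ 2) := by
      rw [div_le_iff₀ (by linarith), sq_abs, mul_pow]
      nlinarith [mul_nonneg (sq_nonneg z) (sq_nonneg h)]
    have hpos : 0 < |h| := abs_pos.2 h0
    have e : Real.log (1 + z * h) / h - z = (-(z * h) + Real.log (1 + z * h)) / h := by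
      field_simp; ring
    rw [e, abs_div, div_le_iff₀ hpos]
    refine (key.trans hle).trans (le_of_eq ?_)
    rw [mul_assoc, mul_assoc, ← sq, sq_abs]

lemma tendsto_xi {ι : Type*} {l : Filter ι} {h z : ι → ℝ} {c : ℝ} (hh : Tendsto h l (𝓝 0))
    (hz : Tendsto z l (𝓝 c)) : Tendsto (fun i => xi (h i) (z i)) l (𝓝 c) := by
  have h1 : Tendsto (fun i => |z i * h i|) l (𝓝 0) := by simpa using (hz.mul hh).abs
  have h2 : Tendsto (fun i => 2 * z i ^ 2 * |h i|) l (𝓝 0) := by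
    simpa using ((hz.pow 2).const_mul 2).mul hh.abs
  have h3 : Tendsto (fun i => xi (h i) (z i) - z i) l (𝓝 0) := by
    refine squeeze_zero_norm' ?_ h2
    filter_upwards [h1.eventually_le_const (by norm_num : (0 : ℝ) < 1 / 2)] with i hi
    exact abs_xi_sub_le hi
  simpa using h3.add hz

lemma xi_le {h z : ℝ} (hh : 0 ≤ h) (hz : 0 < 1 + h * z) : xi h z ≤ z := by
  unfold xi
  split_ifs with h0
  · exact le_rfl
  · rw [div_le_iff₀ (lt_of_le_of_ne hh (Ne.symm h0))]
    linarith [Real.log_le_sub_one_of_pos (by linarith : 0 < 1 + z * h)]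

lemma RdContinuous.xi_mu {S : Set ℝ} (hu : ¬ BddAbove S) {p : ℝ → ℝ} (hp : RdContinuous S p) :
    RdContinuous S fun t => xi (mu S t) (p t) := by
  have hμ0 : ∀ s, 0 ≤ mu S s := fun s => by
    obtain ⟨z, hz, hsz⟩ := exists_gt_of_unbounded hu s
    exact sub_nonneg.2 (le_sigma hz hsz)
  have hleft : ∀ t ∈ S, ∀ η > 0, ∀ s, t - η < s → s < t → mu S s < η := by
    intro t ht η hη s h1 h2
    have := sigma_le ht h2
    unfold mu
    linarith
  refine ⟨fun t ht hσ => ?_, fun t ht hcl => ?_⟩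
  · have hmu : Tendsto (mu S) (𝓝[S] t) (𝓝 0) := by
      rw [Metric.tendsto_nhds]
      intro η hη
      obtain ⟨z, hz, htz⟩ := exists_gt_of_unbounded hu t
      obtain ⟨y, hy, hty, hyη⟩ := exists_mem_Ioo_of_sigma_lt (c := t + η) hz htz (by linarith)
      filter_upwards [mem_nhdsWithin_of_mem_nhds
        (Ioo_mem_nhds (by linarith : t - η < t) hty)] with s hs
      rw [Real.dist_eq, sub_zero, abs_of_nonneg (hμ0 s)]
      rcases lt_trichotomy s t with h | h | h
      · exact hleft t ht η hη s hs.1 h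
      · simpa [mu, h, hσ] using hη
      · have := sigma_le hy hs.2
        unfold mu
        linarith
    have h0 : xi (mu S t) (p t) = p t := by simp [xi, mu, hσ]
    rw [ContinuousWithinAt, h0]
    exact tendsto_xi hmu (hp.1 t ht hσ)
  · obtain ⟨l, hl⟩ := hp.2 t ht hcl
    refine ⟨l, tendsto_xi ?_ hl⟩
    rw [Metric.tendsto_nhds]
    intro η hη
    filter_upwards [self_mem_nhdsWithin,
      mem_nhdsWithin_of_mem_nhds (Ioi_mem_nhds (by linarith : t - η < t))] with s hs hs'
    rw [Real.dist_eq, sub_zero, abs_of_nonneg (hμ0 s)]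
    exact hleft t ht η hη s hs' hs.2

end Antiderivative

end

section

variable {E : Type*} [NormedAddCommGroup E] [NormedSpace ℝ E]

/-! ### The fundamental matrix -/

lemma RdContinuous.map {Y Z : Type*} [TopologicalSpace Y] [TopologicalSpace Z] {S : Set ℝ}
    {f : ℝ → Y} (hf : RdContinuous S f) {φ : Y → Z} (hφ : Continuous φ) :
    RdContinuous S fun t => φ (f t) := by
  refine ⟨fun t ht hσ => hφ.continuousAt.comp_continuousWithinAt (hf.1 t ht hσ),
    fun t ht hcl => ?_⟩
  obtain ⟨l, hl⟩ := hf.2 t ht hcl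
  exact ⟨φ l, (hφ.tendsto l).comp hl⟩

lemma RdContinuous.add {Y : Type*} [TopologicalSpace Y] [Add Y] [ContinuousAdd Y] {S : Set ℝ}
    {f g : ℝ → Y} (hf : RdContinuous S f) (hg : RdContinuous S g) :
    RdContinuous S fun t => f t + g t := by
  refine ⟨fun t ht hσ => (hf.1 t ht hσ).add (hg.1 t ht hσ), fun t ht hcl => ?_⟩
  obtain ⟨l, hl⟩ := hf.2 t ht hcl
  obtain ⟨m, hm⟩ := hg.2 t ht hcl
  exact ⟨l + m, hl.add hm⟩

section Fundamental

variable {T : Set ℝ} {A : ℝ → E →L[ℝ] E} {s t τ : ℝ}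

lemma fundamentalMatrix_spec [CompleteSpace E] (hT : IsClosed T) (hu : ¬ BddAbove T)
    (hA : RdContinuous (plus T 0) A) (hs : s ∈ plus T 0) :
    IsSolutionOn (plus T s) (fun τ Y => A τ * Y) (fun t => fundamentalMatrix T A t s) ∧
      fundamentalMatrix T A s s = 1 := by
  have hA' : RdContinuous (plus T s) A := hA.mono_plus hs.2
  have h : ∃ Y : ℝ → E →L[ℝ] E, IsSolutionOn (plus T s) (fun τ Y => A τ * Y) Y ∧ Y s = 1 := by
    refine exists_solution hT hu hs.1
      (fun Y => hA'.map (φ := fun B => B * Y) (by fun_prop)) (fun b => ?_) 1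
    obtain ⟨M, hM⟩ := hA'.exists_norm_le hT hu b
    refine ⟨M.toNNReal, fun t ht => LipschitzWith.of_dist_le_mul fun Y Z => ?_⟩
    rw [dist_eq_norm, dist_eq_norm, ← mul_sub]
    refine (norm_mul_le _ _).trans ?_
    gcongr
    exact (hM t ht).trans (Real.le_coe_toNNReal M)
  have e : (fun t => fundamentalMatrix T A t s) = h.choose := by
    funext t
    rw [fundamentalMatrix, dif_pos h]
  rw [e, show fundamentalMatrix T A s s = h.choose s from congrFun e s]
  exact h.choose_spec

lemma fundamentalMatrix_right_deriv [CompleteSpace E] (hT : IsClosed T) (hu : ¬ BddAbove T)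
    (hA : RdContinuous (plus T 0) A) (hs : s ∈ plus T 0) (ht : t ∈ plus T s) :
    HasRightDeltaDerivAt T (fun τ => fundamentalMatrix T A τ s)
      (A t * fundamentalMatrix T A t s) t := by
  obtain ⟨z, hz, htz⟩ := exists_gt_of_unbounded hu t
  exact ((fundamentalMatrix_spec hT hu hA hs).1.2 t ht
    ⟨z, ⟨hz, le_trans ht.2 htz.le⟩, htz⟩).right_of_plus ht

lemma fundamentalMatrix_mul [CompleteSpace E] (hT : IsClosed T) (hu : ¬ BddAbove T)
    (hA : RdContinuous (plus T 0) A) (hs : s ∈ plus T 0) (ht : t ∈ plus T s)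
    (hτ : τ ∈ plus T t) :
    fundamentalMatrix T A τ s = fundamentalMatrix T A τ t * fundamentalMatrix T A t s := by
  have ht0 : t ∈ plus T 0 := plus_subset_plus T hs.2 ht
  obtain ⟨M, hM⟩ := hA.exists_norm_le hT hu τ
  have hsub : segment T t τ ⊆ plus T s :=
    (segment_subset_plus T t τ).trans (plus_subset_plus T ht.2)
  have key := norm_le_of_right_deriv hT ht.1 (b := τ) (L := |M|) (K := 0)
    (y := fun r => fundamentalMatrix T A r s -
      fundamentalMatrix T A r t * fundamentalMatrix T A t s)
    (y' := fun r => A r * fundamentalMatrix T A r s -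
      A r * fundamentalMatrix T A r t * fundamentalMatrix T A t s)
    (((fundamentalMatrix_spec hT hu hA hs).1.1.mono hsub).sub
      (((fundamentalMatrix_spec hT hu hA ht0).1.1.mono (segment_subset_plus T t τ)).mul
        continuousOn_const)) (abs_nonneg M) le_rfl ?_ ?_ τ ⟨hτ.1, hτ.2, le_rfl⟩
  · simp only [(fundamentalMatrix_spec hT hu hA ht0).2, one_mul, sub_self, norm_zero, zero_mul,
      add_zero] at key
    exact sub_eq_zero.1 (norm_le_zero_iff.1 key)
  · intro r hr _
    exact (fundamentalMatrix_right_deriv hT hu hA hs (hsub hr)).sub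
      ((fundamentalMatrix_right_deriv hT hu hA ht0 (segment_subset_plus T t τ hr)).clm_comp
        ((ContinuousLinearMap.mul ℝ (E →L[ℝ] E)).flip (fundamentalMatrix T A t s)))
  · intro r hr _
    rw [mul_assoc, ← mul_sub, add_zero]
    refine (norm_mul_le _ _).trans ?_
    gcongr
    exact (hM r ⟨hr.1, (le_trans ht0.2 hr.2.1), hr.2.2⟩).trans (le_abs_self M)

lemma norm_fundamentalMatrix_sub_one_le [CompleteSpace E] (hT : IsClosed T)
    (hu : ¬ BddAbove T) (hA : RdContinuous (plus T 0) A) {M : ℝ} (hM0 : 0 ≤ M)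
    (hs : s ∈ plus T 0) (ht : t ∈ plus T s) (hM : ∀ r ∈ segment T s t, ‖A r‖ ≤ M) :
    ‖fundamentalMatrix T A t s - 1‖ ≤ M * (t - s) * Real.exp (M * (t - s)) := by
  have key := norm_le_of_right_deriv hT hs.1 (b := t) (L := M) (K := M)
    (y := fun r => fundamentalMatrix T A r s - 1)
    (y' := fun r => A r * fundamentalMatrix T A r s - 0)
    (((fundamentalMatrix_spec hT hu hA hs).1.1.mono (segment_subset_plus T s t)).sub
      continuousOn_const) hM0 hM0 ?_ ?_ t ⟨ht.1, ht.2, le_rfl⟩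
  · simpa [(fundamentalMatrix_spec hT hu hA hs).2] using key
  · intro r hr _
    exact (fundamentalMatrix_right_deriv hT hu hA hs (segment_subset_plus T s t hr)).sub
      (hasRightDeltaDerivAt_const T 1 r)
  · intro r hr _
    have h1 : ‖(1 : E →L[ℝ] E)‖ ≤ 1 := ContinuousLinearMap.norm_id_le
    have h2 : ‖fundamentalMatrix T A r s‖ ≤ ‖fundamentalMatrix T A r s - 1‖ + 1 := by
      have := norm_add_le (fundamentalMatrix T A r s - 1) 1
      rw [sub_add_cancel] at this
      linarith
    rw [sub_zero]
    calc _ ≤ ‖A r‖ * ‖fundamentalMatrix T A r s‖ := norm_mul_le _ _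
      _ ≤ M * (‖fundamentalMatrix T A r s - 1‖ + 1) := by gcongr; exact hM r hr
      _ = _ := by ring

end Fundamental

/-! ### Perturbed equations -/

section Perturbation

variable {T : Set ℝ} {A : ℝ → E →L[ℝ] E} {P : ℝ → ℝ} {C κ ε : ℝ}

/-- How a bound for the linear evolution of `y` is passed on to a point `z` close to the image
of `y`. -/
lemma norm_fundamentalMatrix_apply_le_of_near [CompleteSpace E] (hT : IsClosed T)
    (hu : ¬ BddAbove T) (hA : RdContinuous (plus T 0) A) (hC : 0 < C) (hε : 0 < ε)
    (hCε : C * ε * Real.exp 1 ≤ κ)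
    (hΦ : ∀ s ∈ plus T 0, ∀ t ∈ plus T s, ‖fundamentalMatrix T A t s‖ ≤ C * Real.exp (P t - P s))
    {t s k : ℝ} (ht : t ∈ plus T 0) (hs : s ∈ T) (hts : t < s) (hk : 0 < k) {y z : E}
    (hy : ∀ τ ∈ plus T t, ‖fundamentalMatrix T A τ t y‖ ≤ k * Real.exp (P τ - P t))
    (hz : ‖z - fundamentalMatrix T A s t y‖ ≤ (s - t) * (2 * ε * k)) (hP : -1 ≤ P s - P t) :
    ∀ τ ∈ plus T s, ‖fundamentalMatrix T A τ s z‖ ≤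
      k * Real.exp (P s - P t + 2 * κ * (s - t)) * Real.exp (P τ - P s) := by
  intro τ hτ
  have hst : s ∈ plus T t := ⟨hs, hts.le⟩
  have h0 : 0 < s - t := sub_pos.2 hts
  have hs0 : s ∈ plus T 0 := plus_subset_plus T ht.2 hst
  have hmul := fundamentalMatrix_mul hT hu hA ht hst hτ
  have e : fundamentalMatrix T A τ s z =
      fundamentalMatrix T A τ s (z - fundamentalMatrix T A s t y) +
        fundamentalMatrix T A τ t y := by
    rw [hmul]; simp
  have hexp : C * ε ≤ κ * Real.exp (P s - P t) := by
    have h1 : Real.exp (-1) ≤ Real.exp (P s - P t) := Real.exp_le_exp.2 hP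
    have h2 : C * ε = C * ε * Real.exp 1 * Real.exp (-1) := by
      rw [mul_assoc _ (Real.exp 1), ← Real.exp_add]; simp
    have hκ : 0 ≤ κ := le_trans (by positivity) hCε
    rw [h2]
    gcongr
  have h3 : P τ - P t = (P τ - P s) + (P s - P t) := by ring
  calc ‖fundamentalMatrix T A τ s z‖
      ≤ C * Real.exp (P τ - P s) * ((s - t) * (2 * ε * k)) + k * Real.exp (P τ - P t) := by
        rw [e]
        refine (norm_add_le _ _).trans (add_le_add ?_ (hy τ (plus_subset_plus T hts.le hτ)))
        refine (ContinuousLinearMap.le_opNorm _ _).trans ?_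
        gcongr
        exact hΦ s hs0 τ hτ
    _ = k * Real.exp (P τ - P s) * (2 * (s - t) * (C * ε) + Real.exp (P s - P t)) := by
        rw [h3, Real.exp_add]; ring
    _ ≤ k * Real.exp (P τ - P s) *
        (2 * (s - t) * (κ * Real.exp (P s - P t)) + Real.exp (P s - P t)) := by gcongr
    _ = k * Real.exp (P τ - P s) * (Real.exp (P s - P t) * (2 * κ * (s - t) + 1)) := by ring
    _ ≤ k * Real.exp (P τ - P s) * (Real.exp (P s - P t) * Real.exp (2 * κ * (s - t))) := by
        gcongr
        exact Real.add_one_le_exp _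
    _ = _ := by rw [Real.exp_add (P s - P t)]; ring

/-- The growth bound for solutions of the perturbed equation. -/
theorem norm_le_of_perturbation [CompleteSpace E] (hT : IsClosed T) (hu : ¬ BddAbove T)
    (hA : RdContinuous (plus T 0) A) (hC : 0 < C) (hε : 0 < ε) (hCε : C * ε * Real.exp 1 ≤ κ)
    (hΦ : ∀ s ∈ plus T 0, ∀ t ∈ plus T s, ‖fundamentalMatrix T A t s‖ ≤ C * Real.exp (P t - P s))
    (hPc : ContinuousOn P (plus T 0))
    (hPj : ∀ t ∈ plus T 0, t < sigma T t → -1 ≤ P (sigma T t) - P t)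
    {r : ℝ} {f : ℝ → E → E}
    (hf : ∀ t ∈ plus T 0, ∀ x ∈ Metric.ball (0 : E) r, ‖f t x‖ ≤ ε * ‖x‖)
    {a b : ℝ} (ha : a ∈ plus T 0) (hb : b ∈ plus T a) {x : ℝ → E}
    (hx : IsSolutionOn (segment T a b) (fun t x => A t x + f t x) x) {N : ℝ}
    (hN : C * ‖x a‖ < N)
    (hNr : ∀ t ∈ segment T a b, N * Real.exp (P t - P a + 2 * κ * (t - a)) < r) :
    ∀ t ∈ segment T a b, ‖x t‖ ≤ N * Real.exp (P t - P a + 2 * κ * (t - a)) := by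
  set k : ℝ → ℝ := fun t => N * Real.exp (P t - P a + 2 * κ * (t - a)) with hk
  have hN0 : 0 < N := lt_of_le_of_lt (by positivity) hN
  have hk0 : ∀ t, 0 < k t := fun t => by positivity
  have hsub : segment T a b ⊆ plus T 0 :=
    (segment_subset_plus T a b).trans (plus_subset_plus T ha.2)
  have hself : ∀ t ∈ plus T 0,
      (∀ τ ∈ plus T t, ‖fundamentalMatrix T A τ t (x t)‖ ≤ k t * Real.exp (P τ - P t)) →
      ‖x t‖ ≤ k t := fun t ht h => by
    simpa [(fundamentalMatrix_spec hT hu hA ht).2] using h t ⟨ht.1, self_mem_Ici⟩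
  have hkk : ∀ t s, k s = k t * Real.exp (P s - P t + 2 * κ * (s - t)) := by
    intro t s
    simp only [hk]
    rw [mul_assoc N, ← Real.exp_add]
    ring_nf
  have hw : ∀ t ∈ segment T a b, t < b →
      HasRightDeltaDerivAt T (fun s => x s - fundamentalMatrix T A s t (x t)) (f t (x t)) t := by
    intro t ht htb
    have h1 := fundamentalMatrix_right_deriv hT hu hA (hsub ht) ⟨ht.1, self_mem_Ici⟩
    have h2 := (hx.right_deriv hb.1 ht htb).sub
      (h1.clm_comp (ContinuousLinearMap.apply ℝ E (x t)))
    simpa [(fundamentalMatrix_spec hT hu hA (hsub ht)).2] using h2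
  have hfx : ∀ t ∈ segment T a b,
      (∀ τ ∈ plus T t, ‖fundamentalMatrix T A τ t (x t)‖ ≤ k t * Real.exp (P τ - P t)) →
      ‖f t (x t)‖ ≤ ε * k t := by
    intro t ht h
    have h1 := hself t (hsub ht) h
    refine (hf t (hsub ht) (x t) ?_).trans (by gcongr)
    simpa using h1.trans_lt (hNr t ht)
  have main : ∀ t ∈ segment T a b, ∀ τ ∈ plus T t,
      ‖fundamentalMatrix T A τ t (x t)‖ ≤ k t * Real.exp (P τ - P t) := by
    refine segment_induction hT ha.1 ?_ ?_ ?_ ?_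
    · intro τ hτ
      refine (ContinuousLinearMap.le_opNorm _ _).trans ?_
      calc _ ≤ C * Real.exp (P τ - P a) * ‖x a‖ := by gcongr; exact hΦ a ha τ hτ
        _ = C * ‖x a‖ * Real.exp (P τ - P a) := by ring
        _ ≤ k a * Real.exp (P τ - P a) := by
          gcongr
          simpa [hk] using hN.le
    · intro t ht htb hσ h
      rw [hkk t (sigma T t)]
      refine norm_fundamentalMatrix_apply_le_of_near hT hu hA hC hε hCε hΦ (hsub ht)
        (sigma_mem hT hb.1 htb) hσ (hk0 t) h ?_ (hPj t (hsub ht) hσ)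
      have h0 : 0 < sigma T t - t := sub_pos.2 hσ
      have hj := (hw t ht htb).jump hσ
      simp only [(fundamentalMatrix_spec hT hu hA (hsub ht)).2, one_apply_eq_self,
        sub_self, zero_add] at hj
      rw [hj, norm_smul, Real.norm_of_nonneg h0.le]
      gcongr
      refine (hfx t ht h).trans ?_
      nlinarith [mul_pos hε (hk0 t)]
    · intro t ht htb hσ h
      have hPt : ∀ᶠ s in 𝓝[T ∩ Ioi t] t, P t - 1 < P s := by
        have hPw : ContinuousWithinAt P (T ∩ Ioi t) t :=
          (hPc t (hsub ht)).mono fun s hs => ⟨hs.1, le_trans (hsub ht).2 (mem_Ioi.1 hs.2).le⟩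
        exact hPw.eventually_const_lt (by linarith)
      filter_upwards [(hw t ht htb).dense hσ (ε * k t) (mul_pos hε (hk0 t)), hPt,
        self_mem_nhdsWithin] with s h1 h2 hs
      rw [hkk t s]
      refine norm_fundamentalMatrix_apply_le_of_near hT hu hA hC hε hCε hΦ (hsub ht)
        hs.1 hs.2 (hk0 t) h ?_ (by linarith)
      have h0 : 0 < s - t := sub_pos.2 hs.2
      simp only [(fundamentalMatrix_spec hT hu hA (hsub ht)).2, one_apply_eq_self,
        sub_self, sub_zero] at h1
      have h3 := norm_add_le (x s - fundamentalMatrix T A s t (x t) - (s - t) • f t (x t))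
        ((s - t) • f t (x t))
      rw [sub_add_cancel, norm_smul, Real.norm_of_nonneg h0.le] at h3
      have h4 := mul_le_mul_of_nonneg_left (hfx t ht h) h0.le
      linarith
    · intro t ht hcl h τ hτ
      set l := 𝓝[segment T a b ∩ Iio t] t with hl
      have : l.NeBot := mem_closure_iff_nhdsWithin_neBot.1 hcl
      have hid : Tendsto (fun s : ℝ => s) l (𝓝 t) := tendsto_id.mono_left nhdsWithin_le_nhds
      have hPl : Tendsto P l (𝓝 (P t)) :=
        (hPc t (hsub ht)).mono_left (nhdsWithin_mono t (inter_subset_left.trans hsub))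
      have hxl : Tendsto x l (𝓝 (x t)) :=
        (hx.1 t ht).mono_left (nhdsWithin_mono t inter_subset_left)
      obtain ⟨M, hM⟩ := hA.exists_norm_le hT hu t
      set d : ℝ → ℝ := fun s => ‖x t - x s‖ +
        |M| * (t - s) * Real.exp (|M| * (t - s)) * ‖x s‖ with hd
      have hdl : Tendsto d l (𝓝 (‖x t - x t‖ +
          |M| * (t - t) * Real.exp (|M| * (t - t)) * ‖x t‖)) := by
        have hts : Tendsto (fun s => |M| * (t - s)) l (𝓝 (|M| * (t - t))) :=
          (hid.const_sub t).const_mul _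
        exact (hxl.const_sub (x t)).norm.add ((hts.mul hts.rexp).mul hxl.norm)
      have hkl : Tendsto k l (𝓝 (k t)) := by
        refine Tendsto.const_mul N (Tendsto.rexp ?_)
        exact (hPl.sub_const _).add ((hid.sub_const a).const_mul _)
      have hlim : Tendsto (fun s => k s * Real.exp (P τ - P s) +
          C * Real.exp (P τ - P t) * d s) l (𝓝 (k t * Real.exp (P τ - P t) +
          C * Real.exp (P τ - P t) * (‖x t - x t‖ +
          |M| * (t - t) * Real.exp (|M| * (t - t)) * ‖x t‖))) :=
        (hkl.mul (hPl.const_sub _).rexp).add (hdl.const_mul _)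
      simp only [sub_self, norm_zero, mul_zero, zero_mul, add_zero] at hlim
      refine ge_of_tendsto hlim ?_
      filter_upwards [self_mem_nhdsWithin] with s hs
      have hst : s < t := hs.2
      have hs0 := hsub hs.1
      have hts : t ∈ plus T s := ⟨ht.1, hst.le⟩
      have hmul := fundamentalMatrix_mul hT hu hA hs0 hts hτ
      have e : fundamentalMatrix T A τ t (x t) = fundamentalMatrix T A τ s (x s) +
          fundamentalMatrix T A τ t (x t - x s - (fundamentalMatrix T A t s - 1) (x s)) := by
        rw [hmul]; simp
      rw [e]
      refine (norm_add_le _ _).trans (add_le_add ?_ ?_)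
      · exact h s hs.1 hst τ (plus_subset_plus T hst.le hτ)
      · refine (ContinuousLinearMap.le_opNorm _ _).trans ?_
        gcongr
        · exact hΦ t (hsub ht) τ hτ
        · refine (norm_sub_le _ _).trans ?_
          refine add_le_add le_rfl ?_
          refine (ContinuousLinearMap.le_opNorm _ _).trans ?_
          gcongr
          refine norm_fundamentalMatrix_sub_one_le hT hu hA (abs_nonneg M) hs0 hts fun q hq => ?_
          exact (hM q ⟨hq.1, le_trans hs0.2 hq.2.1, hq.2.2⟩).trans (le_abs_self M)
  exact fun t ht => hself t (hsub ht) (main t ht)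

end Perturbation

end

section

variable {E : Type*} [NormedAddCommGroup E] [NormedSpace ℝ E]

/-! ### Consequences of a negative central upper exponent -/

/-- If the central upper exponent is negative, the fundamental matrix is bounded by an exponential
`C exp (P(t) - P(s))` whose exponent `P` decays at least linearly. -/
theorem exists_bound_of_centralUpperExponent_neg {T : Set ℝ} (hT : IsClosed T)
    (hT0 : (0 : ℝ) ∈ T) (hu : ¬ BddAbove T) {A : ℝ → E →L[ℝ] E}
    (hχ : centralUpperExponent T A < 0) :
    ∃ P : ℝ → ℝ, ∃ C > 0, ∃ κ > 0, ContinuousOn P (plus T 0) ∧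
      (∀ t ∈ plus T 0, t < sigma T t → -1 ≤ P (sigma T t) - P t) ∧
      (∀ s ∈ plus T 0, ∀ t ∈ plus T s,
        ‖fundamentalMatrix T A t s‖ ≤ C * Real.exp (P t - P s)) ∧
      ∃ t₁, ∀ t ∈ plus T 0, t₁ ≤ t → P t - P 0 ≤ -(3 * κ) * t := by
  obtain ⟨u, hmean'⟩ := iInf_lt_iff.1 hχ
  obtain ⟨⟨hurd, hupos, C, hC, hbound⟩, hmean⟩ := iInf_lt_iff.1 hmean'
  have hS : ¬ BddAbove (plus T 0) := by
    rw [not_bddAbove_iff]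
    intro t
    obtain ⟨z, hz, htz⟩ := exists_gt_of_unbounded hu (max t 0)
    exact ⟨z, ⟨hz, (le_max_right t 0).trans htz.le⟩, (le_max_left t 0).trans_lt htz⟩
  have hμ0 : ∀ t, 0 ≤ mu (plus T 0) t := fun t => by
    obtain ⟨z, hz, htz⟩ := exists_gt_of_unbounded hS t
    exact sub_nonneg.2 (le_sigma hz htz)
  obtain ⟨P, hP, hPint⟩ := hurd.exists_deltaIntegral_eq hT hu hT0
  obtain ⟨U, hU, hUint⟩ := (hurd.xi_mu hS).exists_deltaIntegral_eq hT hu hT0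
  obtain ⟨q, hq1, hq0⟩ := EReal.lt_iff_exists_real_btwn.1 hmean
  have hq : q < 0 := by exact_mod_cast hq0
  have hUP : ∀ s ∈ plus T 0, ∀ t ∈ plus T s, U t - U s ≤ P t - P s := by
    intro s hs t ht
    have hsub : segment T s t ⊆ plus T 0 :=
      (segment_subset_plus T s t).trans (plus_subset_plus T hs.2)
    have := le_of_right_deriv_nonpos hT hs.1 (b := t) (g := fun r => U r - P r)
      (g' := fun r => xi (mu (plus T 0) r) (u r) - u r)
      ((hU.continuousOn.sub hP.continuousOn).mono hsub)
      (fun r hr _ => ((hU r (hsub hr)).right_of_plus (hsub hr)).sub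
        ((hP r (hsub hr)).right_of_plus (hsub hr)))
      (fun r hr _ => sub_nonpos.2 (xi_le (hμ0 r) (hupos r (hsub hr)))) t ⟨ht.1, ht.2, le_rfl⟩
    linarith
  refine ⟨P, C, hC, -q / 3, by linarith, hP.continuousOn, ?_, ?_, ?_⟩
  · intro t ht hσ
    have h1 := ((hP t ht).right_of_plus ht).jump hσ
    have h2 := hupos t ht
    rw [mu, sigma_plus ht.2] at h2
    rw [h1, smul_eq_mul]
    linarith
  · intro s hs t ht
    refine (hbound s hs t (plus_subset_plus T hs.2 ht) ht.2).trans ?_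
    rw [expFun, hUint]
    exact mul_le_mul_of_nonneg_left (Real.exp_le_exp.2 (hUP s hs t ht)) hC.le
  · have hev := eventually_lt_of_limsup_lt hq1
    rw [eventually_inf_principal] at hev
    obtain ⟨t₁, ht₁⟩ := eventually_atTop.1 hev
    refine ⟨max t₁ 1, fun t ht htt => ?_⟩
    have hpos : 0 < t := lt_of_lt_of_le one_pos ((le_max_right _ _).trans htt)
    have h1 := ht₁ t ((le_max_left _ _).trans htt) ht
    have h2 : 1 / t * (P t - P 0) < q := by
      rw [← hPint 0 t]
      exact_mod_cast h1
    rw [one_div, inv_mul_lt_iff₀ hpos] at h2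
    linarith

/-- Exponential decay of small solutions of perturbed equations. -/
theorem exists_exponential_bound [CompleteSpace E] {T : Set ℝ} (hT : IsClosed T)
    (hT0 : (0 : ℝ) ∈ T) (hu : ¬ BddAbove T) {A : ℝ → E →L[ℝ] E} (hA : RdContinuous (plus T 0) A)
    (hχ : centralUpperExponent T A < 0) :
    ∃ ε > 0, ∃ κ > 0, ∀ a ∈ plus T 0, ∃ K > 0, ∀ r > 0, ∀ f : ℝ → E → E,
      (∀ t ∈ plus T 0, ∀ x ∈ Metric.ball (0 : E) r, ‖f t x‖ ≤ ε * ‖x‖) →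
      ∀ b ∈ plus T a, ∀ x : ℝ → E,
        IsSolutionOn (segment T a b) (fun t x => A t x + f t x) x → ‖x a‖ < r / K →
        ∀ t ∈ segment T a b, ‖x t‖ ≤ K * ‖x a‖ * Real.exp (-κ * (t - a)) := by
  obtain ⟨P, C, hC, κ, hκ, hPc, hPj, hΦ, t₁, ht₁⟩ :=
    exists_bound_of_centralUpperExponent_neg hT hT0 hu hχ
  have hε : 0 < κ / (C * Real.exp 1) := by positivity
  refine ⟨κ / (C * Real.exp 1), hε, κ, hκ, fun a ha => ?_⟩
  obtain ⟨B, hB⟩ : ∃ B, ∀ t ∈ plus T a, P t - P a + 3 * κ * (t - a) ≤ B := by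
    obtain ⟨D, hD⟩ := (isCompact_segment hT a t₁).exists_bound_of_continuousOn
      (f := fun t => P t - P a + 3 * κ * (t - a))
      (((hPc.mono ((segment_subset_plus T a t₁).trans (plus_subset_plus T ha.2))).sub
        continuousOn_const).add (by fun_prop))
    refine ⟨max D (P 0 - P a), fun t ht => ?_⟩
    rcases le_total t t₁ with h | h
    · exact ((le_abs_self _).trans (hD t ⟨ht.1, ht.2, h⟩)).trans (le_max_left _ _)
    · have h1 := ht₁ t (plus_subset_plus T ha.2 ht) h
      have h2 : 0 ≤ κ * a := mul_nonneg hκ.le ha.2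
      refine le_trans ?_ (le_max_right _ _)
      linarith
  set K := Real.exp B with hK
  have hK0 : 0 < K := Real.exp_pos B
  have hexp : ∀ t ∈ plus T a,
      Real.exp (P t - P a + 2 * κ * (t - a)) ≤ K * Real.exp (-κ * (t - a)) := by
    intro t ht
    rw [hK, ← Real.exp_add]
    refine Real.exp_le_exp.2 ?_
    linarith [hB t ht]
  refine ⟨C * K, by positivity, fun r hr f hf b hb x hx hxa t ht => ?_⟩
  rw [lt_div_iff₀ (by positivity)] at hxa
  have hxa' : C * ‖x a‖ < r / K := by
    rw [lt_div_iff₀ hK0]; linarith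
  have key : ∀ N, C * ‖x a‖ < N → N < r / K →
      ‖x t‖ ≤ N * (K * Real.exp (-κ * (t - a))) := by
    intro N hN hNr
    have hN0 : 0 < N := lt_of_le_of_lt (by positivity) hN
    rw [lt_div_iff₀ hK0] at hNr
    have hCε : C * (κ / (C * Real.exp 1)) * Real.exp 1 ≤ κ := le_of_eq (by field_simp)
    refine (norm_le_of_perturbation hT hu hA hC hε hCε hΦ hPc hPj hf ha hb
      hx hN (fun s hs => ?_) t ht).trans ?_
    · refine lt_of_le_of_lt ?_ hNr
      gcongr
      refine (hexp s (segment_subset_plus T a b hs)).trans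
        (mul_le_of_le_one_right hK0.le (Real.exp_le_one_iff.2 ?_))
      nlinarith [hs.2.1]
    · gcongr
      exact hexp t (segment_subset_plus T a b ht)
  have hlim : Tendsto (fun N => N * (K * Real.exp (-κ * (t - a)))) (𝓝[>] (C * ‖x a‖))
      (𝓝 (C * ‖x a‖ * (K * Real.exp (-κ * (t - a))))) :=
    (Continuous.tendsto (by fun_prop) _).mono_left nhdsWithin_le_nhds
  have := ge_of_tendsto hlim (by
    filter_upwards [self_mem_nhdsWithin, mem_nhdsWithin_of_mem_nhds (Iio_mem_nhds hxa')]
      with N h1 h2 using key N h1 h2)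
  refine this.trans (le_of_eq ?_)
  ring

/-! ### Radial retraction onto a ball -/

/-- The radial retraction onto the closed ball of radius `ρ` about `0`. -/
def radialRetraction (ρ : ℝ) (x : E) : E := (ρ / max ρ ‖x‖) • x

section Retraction

variable {ρ : ℝ}

lemma radialRetraction_of_norm_le (hρ : 0 < ρ) {x : E} (hx : ‖x‖ ≤ ρ) :
    radialRetraction ρ x = x := by
  rw [radialRetraction, max_eq_left hx, div_self hρ.ne', one_smul]

lemma norm_radialRetraction_le (hρ : 0 < ρ) (x : E) : ‖radialRetraction ρ x‖ ≤ ρ := by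
  have hm : 0 < max ρ ‖x‖ := lt_max_of_lt_left hρ
  rw [radialRetraction, norm_smul, Real.norm_of_nonneg (by positivity), div_mul_eq_mul_div,
    div_le_iff₀ hm]
  gcongr
  exact le_max_right _ _

lemma norm_radialRetraction_sub_le (hρ : 0 < ρ) (x y : E) :
    ‖radialRetraction ρ x - radialRetraction ρ y‖ ≤ 2 * ‖x - y‖ := by
  have hx : 0 < max ρ ‖x‖ := lt_max_of_lt_left hρ
  have hy : 0 < max ρ ‖y‖ := lt_max_of_lt_left hρ
  have e : radialRetraction ρ x - radialRetraction ρ y =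
      (ρ / max ρ ‖x‖) • (x - y) + (ρ / max ρ ‖x‖ - ρ / max ρ ‖y‖) • y := by
    unfold radialRetraction; module
  have h1 : ρ / max ρ ‖x‖ ≤ 1 := (div_le_one hx).2 (le_max_left _ _)
  have h2 : ‖y‖ / max ρ ‖y‖ ≤ 1 := (div_le_one hy).2 (le_max_right _ _)
  have h3 : |max ρ ‖y‖ - max ρ ‖x‖| ≤ ‖x - y‖ := by
    rw [abs_sub_comm, max_comm ρ, max_comm ρ]
    exact (abs_max_sub_max_le_abs ‖x‖ ‖y‖ ρ).trans (abs_norm_sub_norm_le x y)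
  have h4 : |ρ / max ρ ‖x‖ - ρ / max ρ ‖y‖| * ‖y‖ =
      ρ / max ρ ‖x‖ * (‖y‖ / max ρ ‖y‖) * |max ρ ‖y‖ - max ρ ‖x‖| := by
    have : ρ / max ρ ‖x‖ - ρ / max ρ ‖y‖ =
        ρ / (max ρ ‖x‖ * max ρ ‖y‖) * (max ρ ‖y‖ - max ρ ‖x‖) := by field_simp
    rw [this, abs_mul, abs_of_pos (by positivity)]
    field_simp
  calc _ ≤ ρ / max ρ ‖x‖ * ‖x - y‖ + |ρ / max ρ ‖x‖ - ρ / max ρ ‖y‖| * ‖y‖ := by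
        rw [e]
        refine (norm_add_le _ _).trans (le_of_eq ?_)
        rw [norm_smul, norm_smul, Real.norm_of_nonneg (by positivity), Real.norm_eq_abs]
    _ ≤ 1 * ‖x - y‖ + 1 * 1 * ‖x - y‖ := by rw [h4]; gcongr
    _ = 2 * ‖x - y‖ := by ring

end Retraction

/-! ### Existence of small solutions -/

/-- A regular perturbation composed with the retraction gives an equation with global solutions. -/
theorem exists_solution_retracted [CompleteSpace E] {T : Set ℝ} (hT : IsClosed T)
    (hu : ¬ BddAbove T) {A : ℝ → E →L[ℝ] E} (hA : RdContinuous (plus T 0) A) {r ρ : ℝ}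
    (hρ : 0 < ρ) (hρr : ρ < r) {f : ℝ → E → E} (hf : RegularOn T r f) {a : ℝ}
    (ha : a ∈ plus T 0) (x₀ : E) :
    ∃ x : ℝ → E, IsSolutionOn (plus T a) (fun t x => A t x + f t (radialRetraction ρ x)) x ∧
      x a = x₀ := by
  refine exists_solution hT hu ha.1 (fun x => ?_) (fun b => ?_) x₀
  · refine RdContinuous.mono_plus ?_ ha.2
    refine (hA.map (φ := fun B => B x) (by fun_prop)).add (hf.1 (radialRetraction ρ x) ?_)
    simpa using (norm_radialRetraction_le hρ x).trans_lt hρr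
  · obtain ⟨M, hM⟩ := hA.exists_norm_le hT hu b
    obtain ⟨L, hL⟩ := hf.2 b ρ hρr
    refine ⟨M.toNNReal + L * 2, fun t ht => LipschitzWith.of_dist_le_mul fun x y => ?_⟩
    have ht0 : t ∈ segment T 0 b := ⟨ht.1, le_trans ha.2 ht.2.1, ht.2.2⟩
    have h1 : ‖A t (x - y)‖ ≤ M.toNNReal * ‖x - y‖ := by
      refine (ContinuousLinearMap.le_opNorm _ _).trans ?_
      gcongr
      exact (hM t ht0).trans (Real.le_coe_toNNReal M)
    have h2 : ‖f t (radialRetraction ρ x) - f t (radialRetraction ρ y)‖ ≤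
        L * (2 * ‖x - y‖) := by
      refine ((hL t ht0).norm_sub_le (by simpa using norm_radialRetraction_le hρ x)
        (by simpa using norm_radialRetraction_le hρ y)).trans ?_
      gcongr
      exact norm_radialRetraction_sub_le hρ x y
    have e : A t x + f t (radialRetraction ρ x) - (A t y + f t (radialRetraction ρ y)) =
        A t (x - y) + (f t (radialRetraction ρ x) - f t (radialRetraction ρ y)) := by
      rw [map_sub]; abel
    rw [dist_eq_norm, dist_eq_norm, e]
    refine (norm_add_le _ _).trans ?_
    push_cast
    linarith

end

end TimeScale

end

theorem theorem4p4 {E : Type*} [NormedAddCommGroup E] [NormedSpace ℝ E] [FiniteDimensional ℝ E]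
    (T : Set ℝ) (hT : IsClosed T) (hT0 : (0 : ℝ) ∈ T) (hTunb : ¬ BddAbove T)
    (A : ℝ → E →L[ℝ] E)
    (hArd : TimeScale.RdContinuous (TimeScale.plus T 0) A)
    (hAbdd : ∃ M : ℝ, ∀ t ∈ TimeScale.plus T 0, ‖A t‖ ≤ M)
    (hAreg : TimeScale.Regressive (TimeScale.plus T 0) A)
    (hχ : TimeScale.centralUpperExponent T A < 0) :
    ∃ ε > 0, ∃ κ > 0, ∀ r > 0, ∀ f : ℝ → E → E,
      (∀ t ∈ TimeScale.plus T 0, ∀ x ∈ Metric.ball (0 : E) r, ‖f t x‖ ≤ ε * ‖x‖) →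
        TimeScale.ZeroAsymptoticallyStable T (fun t x => A t x + f t x) ∧
        TimeScale.ZeroExponentiallyStable T (fun t x => A t x + f t x) κ ∧
        (TimeScale.RegularOn T r f →
          TimeScale.SmallSolutionsGlobal T r (fun t x => A t x + f t x)) := by
  open TimeScale in
  have : CompleteSpace E := FiniteDimensional.complete ℝ E
  obtain ⟨ε, hε, κ, hκ, hbound⟩ := exists_exponential_bound hT hT0 hTunb hArd hχ
  refine ⟨ε, hε, κ, hκ, fun r hr f hf => ?_⟩
  have hdecay : ∀ a t : ℝ, a ≤ t → Real.exp (-κ * (t - a)) ≤ 1 := fun a t hat =>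
    Real.exp_le_one_iff.2 (by nlinarith)
  refine ⟨⟨fun a ha η hη => ?_, fun a ha => ?_⟩, fun a ha => ?_, fun hreg a ha => ?_⟩
  · obtain ⟨K, hK, h⟩ := hbound a ha
    refine ⟨min (r / K) (η / K), by positivity, fun b hb x hx hxa t ht => ?_⟩
    refine (h r hr f hf b hb x hx (hxa.trans_le (min_le_left _ _)) t ht).trans_lt ?_
    have h1 : ‖x a‖ * K < η := (lt_div_iff₀ hK).1 (hxa.trans_le (min_le_right _ _))
    refine (mul_le_of_le_one_right (by positivity) (hdecay a t ht.2.1)).trans_lt ?_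
    linarith
  · obtain ⟨K, hK, h⟩ := hbound a ha
    refine ⟨r / K, by positivity, fun x hx hxa => ?_⟩
    have hlim : Filter.Tendsto (fun t => K * ‖x a‖ * Real.exp (-κ * (t - a))) Filter.atTop
        (nhds 0) := by
      have h1 : Filter.Tendsto (fun t : ℝ => κ * (t - a)) Filter.atTop Filter.atTop :=
        (Filter.tendsto_atTop_add_const_right _ (-a) Filter.tendsto_id).const_mul_atTop hκ
      have h2 := (Real.tendsto_exp_neg_atTop_nhds_zero.comp h1).const_mul (K * ‖x a‖)
      simpa [Function.comp_def] using h2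
    refine squeeze_zero_norm' ?_ (hlim.mono_left inf_le_left)
    refine Filter.eventually_inf_principal.2 (Filter.Eventually.of_forall fun t ht => ?_)
    exact h r hr f hf t ht x (hx.segment ht.1) hxa t ⟨ht.1, ht.2, le_rfl⟩
  · obtain ⟨K, hK, h⟩ := hbound a ha
    exact ⟨r / K, by positivity, K, hK, h r hr f hf⟩
  · obtain ⟨K, hK, h⟩ := hbound a ha
    have hρ : 0 < r / 2 := by positivity
    have hρr : r / 2 < r := by linarith
    refine ⟨r / 2 / K, by positivity, fun x₀ hx₀ => ?_⟩
    obtain ⟨x, hx, hxa⟩ := exists_solution_retracted hT hTunb hArd hρ hρr hreg ha x₀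
    have hx₀' : K * ‖x₀‖ < r / 2 := by
      rw [lt_div_iff₀ hK] at hx₀; linarith
    have hsmall : ∀ t ∈ TimeScale.plus T a, ‖x t‖ < r / 2 := by
      intro t ht
      have hft : ∀ t ∈ TimeScale.plus T 0, ∀ x ∈ Metric.ball (0 : E) (r / 2),
          ‖f t (radialRetraction (r / 2) x)‖ ≤ ε * ‖x‖ := by
        intro t ht x hx
        rw [radialRetraction_of_norm_le hρ (by simpa using (mem_ball_zero_iff.1 hx).le)]
        exact hf t ht x (Metric.ball_subset_ball hρr.le hx)
      have h1 := h (r / 2) hρ _ hft t ht x (hx.segment ht.1) (by rwa [hxa]) t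
        ⟨ht.1, ht.2, le_rfl⟩
      rw [hxa] at h1
      exact (h1.trans (mul_le_of_le_one_right (by positivity) (hdecay a t ht.2))).trans_lt hx₀'
    have hxsol : IsSolutionOn (TimeScale.plus T a) (fun t x => A t x + f t x) x := by
      refine ⟨hx.1, fun t ht hlater => ?_⟩
      have h1 := hx.2 t ht hlater
      simp only at h1
      rwa [radialRetraction_of_norm_le hρ (hsmall t ht).le] at h1
    refine ⟨x, hxsol, hxa, fun t ht => ?_, fun b hb y hy hya => ?_⟩
    · simpa using (hsmall t ht).trans hρr
    · have hysmall : ∀ t ∈ TimeScale.segment T a b, ‖y t‖ < r / 2 := by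
        intro t ht
        have h1 := h r hr f hf b hb y hy (by rw [hya]; exact hx₀.trans (by gcongr)) t ht
        rw [hya] at h1
        exact (h1.trans (mul_le_of_le_one_right (by positivity)
          (hdecay a t ht.2.1))).trans_lt hx₀'
      obtain ⟨M, hM⟩ := hAbdd
      obtain ⟨L, hL⟩ := hreg.2 b (r / 2) hρr
      refine hy.eqOn hT ha.1 hb.1 (hxsol.segment hb.1) (L := |M| + L) (by positivity)
        (fun t ht => ?_) (hya.trans hxa.symm)
      have ht0 : t ∈ TimeScale.plus T 0 := ⟨ht.1, le_trans ha.2 ht.2.1⟩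
      have e : A t (y t) + f t (y t) - (A t (x t) + f t (x t)) =
          A t (y t - x t) + (f t (y t) - f t (x t)) := by
        rw [map_sub]; abel
      have h1 : ‖A t (y t - x t)‖ ≤ |M| * ‖y t - x t‖ := by
        refine (ContinuousLinearMap.le_opNorm _ _).trans ?_
        gcongr
        exact (hM t ht0).trans (le_abs_self M)
      have h2 : ‖f t (y t) - f t (x t)‖ ≤ L * ‖y t - x t‖ :=
        (hL t ⟨ht.1, ht0.2, ht.2.2⟩).norm_sub_le (by simpa using (hysmall t ht).le)
          (by simpa using (hsmall t ⟨ht.1, ht.2.1⟩).le)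
      rw [e, add_mul]
      exact (norm_add_le _ _).trans (add_le_add h1 h2)
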